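/- Let $p$ be a prime, $k\ge 1$, and let $a,b\in[1,p-1]$ be primitive roots modulo $p$ with $ab\equiv 1 \pmod p$. Permutations act on the right, $g^h=h^{-1}gh$, and $[x,y]$ denotes an interval of integers. **Groups.** Identify $[1,p^k]$ with $p$ consecutive blocks of length $p^{k-1}$, so that $S_{p^{k-1}}\wr S_p\le S_{p^k}$, with elements $(f_1,\dots,f_p;\delta)$. Put $\gamma=(1,2,\dots,p)$, and let $\sigma_1^{(1)}$ be the permutation $i\mapsto ai \pmod p$ of $[1,p]$ (fixing $p$), with inverse $\tau\colon i\mapsto bi \pmod p$; extend $\tau$ to $[0,p]$ by $(0)\tau=0$. Define recursively $g_k^{(k)}=(1,\dots,1;\gamma)$ and $g_j^{(k)}=(g_j^{(k-1)},1,\dots,1;1)$ for $j<k$, and let $P_{p^k}=\langle g_1^{(k)},\dots,g_k^{(k)}\rangle=P_{p^{k-1}}\wr P_p$ (with $P_1=1$), a Sylow $p$-subgroup of $S_{p^k}$ with normalizer $N_{p^k}$. Define $\sigma_k^{(k)}=(1,\dots,1;\sigma_1^{(1)})$ (which permutes the blocks) and $\sigma_j^{(k)}=(\sigma_j^{(k-1)},\dots,\sigma_j^{(k-1)};1)$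 for $1\le j<k$; these lie in $N_{p^k}$. The group $N_{p^k}$ acts on the set $\mathrm{Irr}(P_{p^k})$ of complex irreducible characters by $\theta^h(g)=\theta(hgh^{-1})$. **Tree functions.** A labeling function of height $k$ assigns a label in $[0,p]$ to each sequence of length less than $k$ with symbols in $[1,p]$ (the vertices of the complete $p$-ary rooted tree with $k$ levels). Two labeling functions are equivalent if one is obtained from the other by permuting cyclically, by powers of $\gamma$, the $p$ subtrees below each non-leaf vertex; the classes are the $p^k$-tree functions. Write $(T_1\mid\dots\mid T_p;x)$ for the tree function with root label $x$ and the $p^{k-1}$-tree functions $T_1,\dots,T_p$ as the subfunctions below the root. A tree function is admissible if no leaf has label $p$ and, at every other vertex, the $p$ tree subfunctions below it are all equal if its label is in $[0,p-1]$, and not all equal if its label is $p$. **Correspondence.** Let $\varphi_\varepsilon$ be the linear character of $P_p=\langle\gamma\rangle$ with $\varphi_\varepsilon(\gamma)=e^{2\pi i\varepsilon/p}$. For $\varphi\in\mathrm{Irr}(P_{p^{k-1}})$ afforded by $V$ and $\varepsilon\in[0,p-1]$, let $\mathcal X(\varphi;\varepsilon)$ be the product of the character of the natural extension of $V^{\otimes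 p}$ to $P_{p^{k-1}}\wr P_p$ with the inflation of $\varphi_\varepsilon$. To $\theta\in\mathrm{Irr}(P_{p^k})$ one associates recursively a $p^k$-tree function $\mathcal T(\theta)$: the empty one if $k=0$; $(\mathcal T(\varphi)\mid\dots\mid\mathcal T(\varphi);\varepsilon)$ if $\theta=\mathcal X(\varphi;\varepsilon)$; and $(\mathcal T(\theta_1)\mid\dots\mid\mathcal T(\theta_p);p)$ if $\theta$ is induced from the character $\theta_1\times\dots\times\theta_p$ of $(P_{p^{k-1}})^{p}$ with $\theta_1,\dots,\theta_p\in\mathrm{Irr}(P_{p^{k-1}})$ not all equal. In particular $\mathcal T(\varphi_\varepsilon)$ is the single vertex labelled $\varepsilon$. The group $N_{p^k}$ acts on the tree functions of irreducible characters by $\mathcal T(\theta)^h=\mathcal T(\theta^h)$, which is well defined. **Theorem.** Let $\theta\in\mathrm{Irr}(P_{p^k})$ and write $\mathcal T(\theta)=(\mathcal T_1\mid\dots\mid\mathcal T_p;x)$. Then $\mathcal T(\theta)$ and $\mathcal T_1,\dots,\mathcal T_p$ are admissible, and for $j\in[1,k]$ $$\mathcal T(\theta)^{\sigma_j^{(k)}}=\begin{cases}(\mathcal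 T_1^{\sigma_j^{(k-1)}}\mid\dots\mid\mathcal T_p^{\sigma_j^{(k-1)}};\,x) & \text{if } j<k,\\[2pt] (\mathcal T_{(1)\tau}\mid\dots\mid\mathcal T_{(p)\tau};\,(x)\tau) & \text{if } j=k.\end{cases}$$ -/

import Mathlib

open scoped TensorProduct

namespace SylowTree

/-! ### Permutations of `[1, p ^ k]`

The set `[1, n]` is `Fin n`, with `i : Fin n` standing for the number `i + 1`. Permutations compose
as functions (from right to left). Conjugation `g ^ h`, written as `h⁻¹ g h` when permutations act
on the right, is therefore `h * g * h⁻¹` here. -/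

/-- The `p`-cycle `γ = (1, 2, …, p)`. -/
def rot (p : ℕ) [NeZero p] : Equiv.Perm (Fin p) := Equiv.addRight 1

/-- The bijection of `[1, p]` with the residues modulo `p`; the number `i + 1` is sent to its
class. -/
def residue (p : ℕ) [NeZero p] : Fin p ≃ ZMod p :=
  (ZMod.finEquiv p).toEquiv.trans (Equiv.addRight 1)

/-- The permutation `σ₁⁽¹⁾` of `[1, p]`, which is `i ↦ a i` modulo `p` (and fixes `p`). If `a` is a
primitive root modulo `p`, this is the cycle `(a₁, …, a_{p-1})` with `a_i ≡ a ^ i`. -/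
def sigmaOne {p : ℕ} [NeZero p] (a : (ZMod p)ˣ) : Equiv.Perm (Fin p) :=
  (residue p).symm.permCongr a.mulLeft

/-- `τ = (σ₁⁽¹⁾)⁻¹` as a permutation of `[1, p]`. -/
def tau {p : ℕ} [NeZero p] (a : (ZMod p)ˣ) : Equiv.Perm (Fin p) := (sigmaOne a)⁻¹

/-- `τ` extended to `[0, p]` by `0 ↦ 0`. Here `x : Fin (p + 1)` stands for the number `x` itself, so
that `i : Fin p`, which stands for `i + 1 ∈ [1, p]`, becomes `i.succ`. -/
def tauLabel {p : ℕ} [NeZero p] (a : (ZMod p)ˣ) (x : Fin (p + 1)) : Fin (p + 1) :=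
  Fin.cases 0 (fun i => (tau a i).succ) x

/-- `[1, p ^ (k + 1)]` consists of `p` consecutive blocks of length `p ^ k`: the pair `(m, r)` is
the `r`-th point of the `m`-th block, that is, the point `m * p ^ k + r`, counted from `0`. -/
def blockEquiv (p k : ℕ) : Fin p × Fin (p ^ k) ≃ Fin (p ^ (k + 1)) :=
  finProdFinEquiv.trans (finCongr (pow_succ' p k).symm)

/-- The element `(f₁, …, f_p; δ)` of the wreath product `S_{p ^ k} ≀ S_p`, as a permutation of
`[1, p ^ (k + 1)]`: the `r`-th point of block `m` is sent to the point `f_{δ(m)}(r)` of block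
`δ(m)`. -/
def wr {p k : ℕ} (f : Fin p → Equiv.Perm (Fin (p ^ k))) (δ : Equiv.Perm (Fin p)) :
    Equiv.Perm (Fin (p ^ (k + 1))) :=
  (blockEquiv p k).permCongr (Equiv.prodShear δ fun m => f (δ m))

/-- The permutations `g_1⁽ᵏ⁾, …, g_k⁽ᵏ⁾` of `[1, p ^ k]`; the index `j : Fin k` stands for `j + 1`.
The last one permutes the `p` blocks cyclically, `g_k⁽ᵏ⁾ = (1, …, 1; γ)`, and
`g_j⁽ᵏ⁾ = (g_j⁽ᵏ⁻¹⁾, 1, …, 1; 1)` for `j < k`. -/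
def gen (p : ℕ) [NeZero p] : (k : ℕ) → Fin k → Equiv.Perm (Fin (p ^ k))
  | 0 => Fin.elim0
  | k + 1 => Fin.lastCases (wr 1 (rot p)) fun j => wr (Pi.mulSingle 0 (gen p k j)) 1

/-- The Sylow `p`-subgroup `P_{p ^ k} = ⟨g_1⁽ᵏ⁾, …, g_k⁽ᵏ⁾⟩` of `S_{p ^ k}`. -/
def Syl (p : ℕ) [NeZero p] (k : ℕ) : Subgroup (Equiv.Perm (Fin (p ^ k))) :=
  Subgroup.closure (Set.range (gen p k))

/-- The permutations `σ_1⁽ᵏ⁾, …, σ_k⁽ᵏ⁾` of `[1, p ^ k]`; the index `j : Fin k` stands for `j + 1`.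
For `j < k`, `σ_j⁽ᵏ⁾` is the product of the `p` translates of `σ_j⁽ᵏ⁻¹⁾`, one in each block.
The permutation `σ_k⁽ᵏ⁾` permutes the `p` blocks according to `σ₁⁽¹⁾` and keeps the position inside
the block; it is the product of the cycles `(a₁ p ^ (k-1) - i, …, a_{p-1} p ^ (k-1) - i)` over
`0 ≤ i < p ^ (k - 1)`. -/
def sigma {p : ℕ} [NeZero p] (a : (ZMod p)ˣ) : (k : ℕ) → Fin k → Equiv.Perm (Fin (p ^ k))
  | 0 => Fin.elim0
  | k + 1 => Fin.lastCases (wr 1 (sigmaOne a)) fun j => wr (fun _ => sigma a k j) 1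

section facts

theorem wr_mul {p k : ℕ} (f f' : Fin p → Equiv.Perm (Fin (p ^ k))) (δ δ' : Equiv.Perm (Fin p)) :
    wr f δ * wr f' δ' = wr (fun m => f m * f' (δ⁻¹ m)) (δ * δ') := by
  ext x
  simp [wr, Equiv.permCongr_apply, Equiv.prodShear]

theorem wr_one {p k : ℕ} : wr (1 : Fin p → Equiv.Perm (Fin (p ^ k))) 1 = 1 := by
  ext x
  simp [wr, Equiv.permCongr_apply, Equiv.prodShear]

variable {p : ℕ} [NeZero p] {k : ℕ}

/-- The embedding of the base group `(S_{p ^ k}) ^ p`. -/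
def wrBase (p k : ℕ) [NeZero p] :
    (Fin p → Equiv.Perm (Fin (p ^ k))) →* Equiv.Perm (Fin (p ^ (k + 1))) where
  toFun f := wr f 1
  map_one' := wr_one
  map_mul' f f' := by rw [wr_mul]; rfl

/-- The embedding of the top group `S_p`. -/
def wrTop (p k : ℕ) [NeZero p] : Equiv.Perm (Fin p) →* Equiv.Perm (Fin (p ^ (k + 1))) where
  toFun δ := wr 1 δ
  map_one' := wr_one
  map_mul' δ δ' := by rw [wr_mul]; congr 1

theorem wrBase_apply (f : Fin p → Equiv.Perm (Fin (p ^ k))) : wrBase p k f = wr f 1 := rfl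

theorem wrTop_apply (δ : Equiv.Perm (Fin p)) : wrTop p k δ = wr 1 δ := rfl

theorem wr_eq (f : Fin p → Equiv.Perm (Fin (p ^ k))) (δ : Equiv.Perm (Fin p)) :
    wr f δ = wrBase p k f * wrTop p k δ := by
  rw [wrBase_apply, wrTop_apply, wr_mul]
  simp

theorem wr_conj (h : Fin p → Equiv.Perm (Fin (p ^ k))) (δ : Equiv.Perm (Fin p)) :
    wrTop p k δ * wrBase p k h * (wrTop p k δ)⁻¹ = wrBase p k (fun m => h (δ⁻¹ m)) := by
  rw [mul_inv_eq_iff_eq_mul]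
  rw [wrBase_apply, wrBase_apply, wrTop_apply]
  simp only [wr_mul, Pi.one_apply, one_mul, mul_one]

theorem wr_conj_mulSingle (i : Fin p) (x : Equiv.Perm (Fin (p ^ k))) (δ : Equiv.Perm (Fin p)) :
    wrTop p k δ * wrBase p k (Pi.mulSingle i x) * (wrTop p k δ)⁻¹ =
      wrBase p k (Pi.mulSingle (δ i) x) := by
  rw [wr_conj]
  congr 1
  funext m
  by_cases h : m = δ i
  · subst h; simp
  · have h' : δ⁻¹ m ≠ i := by
      rintro rfl; simp at h
    rw [Pi.mulSingle_eq_of_ne h', Pi.mulSingle_eq_of_ne h]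

theorem rot_pow_apply (s : ℕ) (i : Fin p) : (rot p ^ s) i = i + Fin.ofNat p s := by
  induction s with
  | zero => simp
  | succ s ih =>
    rw [pow_succ', Equiv.Perm.mul_apply, ih]
    apply Fin.ext
    simp [rot, Fin.val_add, add_assoc]

theorem exists_rot_pow (m : Fin p) : ∃ s : ℕ, (rot p ^ s) 0 = m :=
  ⟨m.val, by rw [rot_pow_apply]; simp⟩

theorem wrTop_rot_mem : wrTop p k (rot p) ∈ Syl p (k + 1) :=
  Subgroup.subset_closure ⟨Fin.last k, by simp [gen, wrTop]⟩

theorem wrBase_zero_mem {x : Equiv.Perm (Fin (p ^ k))} (hx : x ∈ Syl p k) :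
    wrBase p k (Pi.mulSingle 0 x) ∈ Syl p (k + 1) := by
  have : Syl p k ≤ (Syl p (k + 1)).comap
      ((wrBase p k).comp (MonoidHom.mulSingle (fun _ : Fin p => Equiv.Perm (Fin (p ^ k))) 0)) := by
    refine (Subgroup.closure_le _).2 ?_
    rintro _ ⟨j, rfl⟩
    exact Subgroup.subset_closure ⟨j.castSucc, by simp [gen, wrBase]⟩
  exact this hx

theorem wrBase_single_mem (i : Fin p) {x : Equiv.Perm (Fin (p ^ k))} (hx : x ∈ Syl p k) :
    wrBase p k (Pi.mulSingle i x) ∈ Syl p (k + 1) := by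
  obtain ⟨s, rfl⟩ := exists_rot_pow i
  rw [← wr_conj_mulSingle, map_pow]
  have h := Subgroup.pow_mem _ (wrTop_rot_mem (p := p) (k := k)) s
  exact Subgroup.mul_mem _ (Subgroup.mul_mem _ h (wrBase_zero_mem hx)) (Subgroup.inv_mem _ h)

theorem wrBase_mem {f : Fin p → Equiv.Perm (Fin (p ^ k))} (hf : ∀ i, f i ∈ Syl p k) :
    wrBase p k f ∈ Syl p (k + 1) :=
  Subgroup.pi_mem_of_mulSingle_mem (H := (Syl p (k + 1)).comap (wrBase p k)) f
    fun i => wrBase_single_mem i (hf i)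

theorem wr_mem {f : Fin p → Equiv.Perm (Fin (p ^ k))} (hf : ∀ i, f i ∈ Syl p k) (s : ℕ) :
    wr f (rot p ^ s) ∈ Syl p (k + 1) := by
  rw [wr_eq, map_pow]
  exact Subgroup.mul_mem _ (wrBase_mem hf) (Subgroup.pow_mem _ wrTop_rot_mem s)

theorem residue_rot (i : Fin p) : residue p (rot p i) = residue p i + 1 := by
  simp [residue, rot]

theorem residue_rot_pow (s : ℕ) (i : Fin p) : residue p ((rot p ^ s) i) = residue p i + s := by
  induction s with
  | zero => simp
  | succ s ih => rw [pow_succ', Equiv.Perm.mul_apply, residue_rot, ih]; push_cast; ring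

theorem residue_sigmaOne (a : (ZMod p)ˣ) (i : Fin p) :
    residue p (sigmaOne a i) = a * residue p i := by
  simp [sigmaOne, Equiv.permCongr_apply]

theorem sigmaOne_conj (a : (ZMod p)ˣ) :
    sigmaOne a * rot p * (sigmaOne a)⁻¹ = rot p ^ (a : ZMod p).val := by
  rw [mul_inv_eq_iff_eq_mul]
  ext1 i
  apply (residue p).injective
  rw [Equiv.Perm.mul_apply, Equiv.Perm.mul_apply, residue_sigmaOne, residue_rot, residue_rot_pow,
    residue_sigmaOne, ZMod.natCast_zmod_val]
  ring

theorem mem_normalizer_of_gen {h : Equiv.Perm (Fin (p ^ k))}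
    (H : ∀ j, h * gen p k j * h⁻¹ ∈ Syl p k) : h ∈ Subgroup.normalizer (Syl p k : Set _) := by
  have hle : (Syl p k).map (MulAut.conj h).toMonoidHom ≤ Syl p k := by
    rw [Syl, MonoidHom.map_closure, Subgroup.closure_le]
    rintro _ ⟨_, ⟨j, rfl⟩, rfl⟩
    exact H j
  have heq := Subgroup.eq_of_le_of_card_ge hle (by
    rw [Subgroup.card_map_of_injective (MulAut.conj h).injective])
  rw [Subgroup.mem_normalizer_iff]
  intro g
  constructor
  · intro hg
    exact hle ⟨g, hg, rfl⟩
  · intro hg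
    rw [← SetLike.mem_coe, SetLike.mem_coe, ← heq] at hg
    obtain ⟨g', hg', e⟩ := hg
    have : g' = g := (MulAut.conj h).injective e
    exact this ▸ hg'

/-- `σ_j⁽ᵏ⁾` normalizes `P_{p ^ k}`. -/
theorem sigma_mem (a : (ZMod p)ˣ) :
    ∀ (k : ℕ) (j : Fin k), sigma a k j ∈ Subgroup.normalizer (Syl p k : Set _)
  | 0, j => j.elim0
  | k + 1, j => by
    apply mem_normalizer_of_gen
    have hlast : gen p (k + 1) (Fin.last k) = wrTop p k (rot p) := by simp [gen, wrTop]
    have hcast : ∀ i : Fin k, gen p (k + 1) i.castSucc =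
      wrBase p k (Pi.mulSingle 0 (gen p k i)) := fun i => by simp [gen, wrBase]
    have hgen : ∀ i : Fin k, gen p k i ∈ Syl p k := fun i => Subgroup.subset_closure ⟨i, rfl⟩
    induction j using Fin.lastCases with
    | last =>
      have hs : sigma a (k + 1) (Fin.last k) = wrTop p k (sigmaOne a) := by simp [sigma, wrTop]
      rw [hs]
      intro i
      induction i using Fin.lastCases with
      | last =>
        rw [hlast, ← map_inv, ← map_mul, ← map_mul, sigmaOne_conj, map_pow]
        exact Subgroup.pow_mem _ wrTop_rot_mem _
      | cast i =>
        rw [hcast, wr_conj_mulSingle]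
        exact wrBase_single_mem _ (hgen i)
    | cast j =>
      have hs : sigma a (k + 1) j.castSucc = wrBase p k (fun _ => sigma a k j) := by
        simp [sigma, wrBase]
      rw [hs]
      intro i
      induction i using Fin.lastCases with
      | last =>
        rw [hlast]
        have := wr_conj (p := p) (k := k) (fun _ => sigma a k j) (rot p)
        rw [mul_inv_eq_iff_eq_mul] at this
        rw [← this, mul_inv_cancel_right]
        exact wrTop_rot_mem
      | cast i =>
        rw [hcast, ← map_inv, ← map_mul, ← map_mul]
        apply wrBase_mem
        intro m
        have := (Subgroup.mem_normalizer_iff.1 (sigma_mem a k j) _).1 (hgen i)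
        by_cases hm : m = 0
        · subst hm; simpa using this
        · simp [Pi.mulSingle_eq_of_ne hm]

end facts

/-- The normalizer `N_{p ^ k}` of `P_{p ^ k}` in `S_{p ^ k}`. -/
abbrev Nor (p : ℕ) [NeZero p] (k : ℕ) : Subgroup (Equiv.Perm (Fin (p ^ k))) :=
  Subgroup.normalizer (Syl p k : Set (Equiv.Perm (Fin (p ^ k))))

/-- `σ_j⁽ᵏ⁾` as an element of `N_{p ^ k}`. -/
def sigmaN {p : ℕ} [NeZero p] (a : (ZMod p)ˣ) (k : ℕ) (j : Fin k) : Nor p k :=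
  ⟨sigma a k j, sigma_mem a k j⟩

/-- The element `(f₁, …, f_p; γ ^ s)` of `P_{p ^ (k + 1)} = P_{p ^ k} ≀ P_p`. -/
def wreath {p : ℕ} [NeZero p] {k : ℕ} (f : Fin p → Syl p k) (s : ℕ) : Syl p (k + 1) :=
  ⟨wr (fun i => (f i : Equiv.Perm (Fin (p ^ k)))) (rot p ^ s), wr_mem (fun i => (f i).2) s⟩

/-! ### Characters -/

/-- `χ` is the character of an irreducible complex representation of `G`. -/
def IsIrrChar {G : Type*} [Group G] (χ : G → ℂ) : Prop :=
  ∃ (n : ℕ) (ρ : Representation ℂ G (Fin n → ℂ)), ρ.IsIrreducible ∧ ρ.character = χ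

/-- The conjugate character `θ ^ h`, with `θ ^ h (g) = θ (g ^ (h⁻¹))`. -/
def conjChar {p : ℕ} [NeZero p] {k : ℕ} (h : Nor p k) (θ : Syl p k → ℂ) : Syl p k → ℂ := fun g =>
  θ ⟨(h : Equiv.Perm (Fin (p ^ k)))⁻¹ * g * h, (Subgroup.mem_normalizer_iff''.1 h.2 _).1 g.2⟩

open Classical in
/-- The character of a finite group `G` induced from the class function `ψ` of a group `H`, along an
injective homomorphism `ι`:
`g ↦ |H|⁻¹ ∑_{x ∈ G} ψ°(x⁻¹ g x)`, where `ψ°` is `ψ` on `ι(H) = H` and `0` elsewhere. -/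
noncomputable def indChar {G H : Type*} [Group G] [Group H] [Finite G] [Finite H]
    (ι : H → G) (ψ : H → ℂ) (g : G) : ℂ :=
  letI := Fintype.ofFinite G
  letI := Fintype.ofFinite H
  (Nat.card H : ℂ)⁻¹ * ∑ x : G, ∑ h : H, if ι h = x⁻¹ * g * x then ψ h else 0

/-- The character `(θ₁ × ⋯ × θ_p)↑` of `P_{p ^ (k + 1)}`, induced from the base group
`(P_{p ^ k}) ^ p`. -/
noncomputable def indProd {p : ℕ} [NeZero p] {k : ℕ} (θ : Fin p → Syl p k → ℂ) :
    Syl p (k + 1) → ℂ :=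
  indChar (fun f : Fin p → Syl p k => wreath f 0) fun f => ∏ i, θ i (f i)

/-- For a representation `V` of `G`, the action of `(f₁, …, f_p; δ)` on `V ⊗ ⋯ ⊗ V` (`p` factors),
`v₁ ⊗ ⋯ ⊗ v_p ↦ f₁ v_{δ⁻¹(1)} ⊗ ⋯ ⊗ f_p v_{δ⁻¹(p)}`. -/
noncomputable def tensorAct {p n : ℕ} {G : Type*} [Group G] (ρ : Representation ℂ G (Fin n → ℂ))
    (f : Fin p → G) (δ : Equiv.Perm (Fin p)) :
    (⨂[ℂ] _ : Fin p, (Fin n → ℂ)) →ₗ[ℂ] ⨂[ℂ] _ : Fin p, (Fin n → ℂ) :=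
  PiTensorProduct.map (fun i => ρ (f i)) ∘ₗ
    (PiTensorProduct.reindex ℂ (fun _ : Fin p => Fin n → ℂ) δ).toLinearMap

/-- `ω = exp (2 π i / p)`. -/
noncomputable def omega (p : ℕ) : ℂ := Complex.exp (2 * Real.pi * Complex.I / p)

/-- `θ` is the character `𝒳(φ; ε)` of `P_{p ^ (k + 1)} = P_{p ^ k} ≀ P_p`: the character of the
representation on `V ⊗ ⋯ ⊗ V`, where `V` affords `φ`, times the inflation of the linear character
`φ_ε` of `P_p`, which is given by `φ_ε (γ ^ s) = ω ^ (ε s)`. -/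
def IsX {p : ℕ} [NeZero p] {k : ℕ} (φ : Syl p k → ℂ) (ε : Fin p) (θ : Syl p (k + 1) → ℂ) : Prop :=
  ∃ (n : ℕ) (ρ : Representation ℂ (Syl p k) (Fin n → ℂ)), ρ.character = φ ∧
    ∀ (f : Fin p → Syl p k) (s : ℕ),
      θ (wreath f s) =
        LinearMap.trace ℂ _ (tensorAct ρ f (rot p ^ s)) * omega p ^ ((ε : ℕ) * s)

/-! ### Tree functions -/

/-- The `p ^ k`-skeleton: sequences of length less than `k` with symbols in `[1, p]`. -/
abbrev Skel (p k : ℕ) : Type := {s : List (Fin p) // s.length < k}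

/-- Labeling functions: the labels are in `[0, p]`. -/
abbrev LabelFn (p k : ℕ) : Type := Skel p k → Fin (p + 1)

/-- The sequence `(s₁)γ_{s⁰} (s₂)γ_{s¹} … (s_ℓ)γ_{s^{ℓ-1}}`, where `sⁱ = s₁ … s_i`. -/
def relabel {p : ℕ} : (List (Fin p) → Equiv.Perm (Fin p)) → List (Fin p) → List (Fin p)
  | _, [] => []
  | γ, i :: s => γ [] i :: relabel (fun q => γ (i :: q)) s

theorem relabel_length {p : ℕ} (γ : List (Fin p) → Equiv.Perm (Fin p)) (s : List (Fin p)) :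
    (relabel γ s).length = s.length := by
  induction s generalizing γ with
  | nil => rfl
  | cons i s ih => simp [relabel, ih]

theorem relabel_one {p : ℕ} (s : List (Fin p)) : relabel (fun _ => 1) s = s := by
  induction s with
  | nil => rfl
  | cons i s ih => simp [relabel, ih]

theorem relabel_relabel {p : ℕ} (γ γ' : List (Fin p) → Equiv.Perm (Fin p)) (s : List (Fin p)) :
    relabel γ' (relabel γ s) = relabel (fun q => γ' (relabel γ q) * γ q) s := by
  induction s generalizing γ γ' with
  | nil => rfl
  | cons i s ih => simp [relabel, ih]

theorem exists_relabel_inv {p : ℕ} (C : Subgroup (Equiv.Perm (Fin p)))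
    (γ : List (Fin p) → Equiv.Perm (Fin p)) (hγ : ∀ q, γ q ∈ C) :
    ∃ γ' : List (Fin p) → Equiv.Perm (Fin p), (∀ q, γ' q ∈ C) ∧
      ∀ s, relabel γ (relabel γ' s) = s := by
  have key : ∀ s : List (Fin p), ∃ g : (γ : List (Fin p) → Equiv.Perm (Fin p)) → List (Fin p),
      ∀ γ, relabel γ (g γ) = s := by
    intro s
    induction s with
    | nil => exact ⟨fun _ => [], fun _ => rfl⟩
    | cons i s ih =>
      obtain ⟨g, hg⟩ := ih
      exact ⟨fun γ => (γ [])⁻¹ i :: g (fun q => γ ((γ [])⁻¹ i :: q)), fun γ => by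
        simp [relabel, hg]⟩
  have inj : ∀ (s s' : List (Fin p)) (γ : List (Fin p) → Equiv.Perm (Fin p)),
      relabel γ s = relabel γ s' → s = s' := by
    intro s
    induction s with
    | nil =>
      intro s' γ h
      cases s' with
      | nil => rfl
      | cons i s' => simp [relabel] at h
    | cons i s ih =>
      intro s' γ h
      cases s' with
      | nil => simp [relabel] at h
      | cons i' s' =>
        simp only [relabel, List.cons.injEq, EmbeddingLike.apply_eq_iff_eq] at h
        obtain ⟨rfl, h⟩ := h
        rw [ih _ _ h]
  choose g hg using key
  refine ⟨fun q => (γ (g q γ))⁻¹, fun q => C.inv_mem (hγ _), fun s => ?_⟩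
  clear hγ
  induction s generalizing γ with
  | nil => rfl
  | cons i s ih =>
    have h0 : g [] γ = [] := inj _ _ γ (by rw [hg]; rfl)
    simp only [relabel, h0, List.cons.injEq]
    refine ⟨by simp, ?_⟩
    have h1 : ∀ q, g (i :: q) γ =
        (γ [])⁻¹ i :: g q (fun q => γ ((γ [])⁻¹ i :: q)) := fun q =>
      inj _ _ γ (by rw [hg]; simp [relabel, hg])
    simp only [h1]
    exact ih (fun q => γ ((γ [])⁻¹ i :: q))

/-- The equivalence relation on labeling functions: the subtrees below each vertex may be permuted
cyclically. (Only the values of `γ` at sequences of length less than `k - 1` matter.) -/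
def treeSetoid (p : ℕ) [NeZero p] (k : ℕ) : Setoid (LabelFn p k) where
  r t₁ t₂ := ∃ γ : List (Fin p) → Equiv.Perm (Fin p), (∀ q, γ q ∈ Subgroup.zpowers (rot p)) ∧
    ∀ s : Skel p k, t₁ s = t₂ ⟨relabel γ s, by rw [relabel_length]; exact s.2⟩
  iseqv :=
    { refl := fun t => ⟨fun _ => 1, fun _ => Subgroup.one_mem _, fun s => by simp [relabel_one]⟩
      symm := by
        rintro t₁ t₂ ⟨γ, hγ, h⟩
        obtain ⟨γ', hγ', h'⟩ := exists_relabel_inv _ γ hγ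
        exact ⟨γ', hγ', fun s => by rw [h]; simp [h']⟩
      trans := by
        rintro t₁ t₂ t₃ ⟨γ, hγ, h⟩ ⟨γ', hγ', h'⟩
        exact ⟨fun q => γ' (relabel γ q) * γ q, fun q => Subgroup.mul_mem _ (hγ' _) (hγ _),
          fun s => by rw [h, h']; simp [relabel_relabel]⟩ }

/-- `p ^ k`-tree functions: classes of labeling functions. -/
def TreeFn (p : ℕ) [NeZero p] (k : ℕ) : Type := Quotient (treeSetoid p k)

/-- The class of a labeling function. -/
def TreeFn.mk {p : ℕ} [NeZero p] {k : ℕ} (t : LabelFn p k) : TreeFn p k :=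
  Quotient.mk (treeSetoid p k) t

/-- The label of the root. -/
def LabelFn.root {p k : ℕ} (t : LabelFn p (k + 1)) : Fin (p + 1) := t ⟨[], Nat.succ_pos k⟩

/-- The labeling subfunction rooted at the `i`-th vertex below the root. -/
def LabelFn.sub {p k : ℕ} (t : LabelFn p (k + 1)) (i : Fin p) : LabelFn p k :=
  fun s => t ⟨i :: s, Nat.succ_lt_succ s.2⟩

/-- The labeling function `(f₁ | ⋯ | f_p; x)`. -/
def LabelFn.node {p k : ℕ} (f : Fin p → LabelFn p k) (x : Fin (p + 1)) : LabelFn p (k + 1)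
  | ⟨[], _⟩ => x
  | ⟨i :: s, h⟩ => f i ⟨s, Nat.lt_of_succ_lt_succ h⟩

/-- The tree function `(F₁ | ⋯ | F_p; x)`, the class of `(f₁ | ⋯ | f_p; x)` for any representatives
`f_i` of `F_i`. -/
noncomputable def TreeFn.node {p : ℕ} [NeZero p] {k : ℕ} (F : Fin p → TreeFn p k)
    (x : Fin (p + 1)) : TreeFn p (k + 1) :=
  TreeFn.mk (LabelFn.node (fun i => Quotient.out (F i)) x)

/-- Admissible labeling functions: leaves are not labelled by `p`, and at each other vertex the `p`
tree subfunctions below it are admissible, all equal if the label of the vertex is not `p`, and not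
all equal if it is `p`. -/
def LabelFn.Admissible {p : ℕ} [NeZero p] : {k : ℕ} → LabelFn p k → Prop
  | 0, _ => True
  | 1, t => LabelFn.root t ≠ Fin.last p
  | _ + 2, t => (∀ i, LabelFn.Admissible (LabelFn.sub t i)) ∧
      (LabelFn.root t ≠ Fin.last p →
        ∀ i j, TreeFn.mk (LabelFn.sub t i) = TreeFn.mk (LabelFn.sub t j)) ∧
      (LabelFn.root t = Fin.last p →
        ∃ i j, TreeFn.mk (LabelFn.sub t i) ≠ TreeFn.mk (LabelFn.sub t j))

/-- Admissible tree functions. -/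
def TreeFn.Admissible {p : ℕ} [NeZero p] {k : ℕ} (T : TreeFn p k) : Prop :=
  ∃ t : LabelFn p k, TreeFn.mk t = T ∧ LabelFn.Admissible t

open Classical in
/-- The map `Φ_{p ^ k}` from `Irr(P_{p ^ k})` to tree functions, `θ ↦ 𝒯(θ)`. It is built recursively
from `P_1 = 1`, whose tree function is the empty one; for `P_p` it sends `φ_ε = 𝒳(1; ε)` to the
one-vertex tree labelled by `ε`. The value in the last line is not attained at irreducible
characters. -/
noncomputable def treeOf {p : ℕ} [NeZero p] : {k : ℕ} → (Syl p k → ℂ) → TreeFn p k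
  | 0, _ => TreeFn.mk fun _ => 0
  | k + 1, θ =>
    if h : ∃ φε : (Syl p k → ℂ) × Fin p, IsIrrChar φε.1 ∧ IsX φε.1 φε.2 θ then
      TreeFn.node (fun _ => treeOf h.choose.1) h.choose.2.castSucc
    else if h : ∃ ϑ : Fin p → Syl p k → ℂ,
        (∀ i, IsIrrChar (ϑ i)) ∧ (∃ i j, ϑ i ≠ ϑ j) ∧ θ = indProd ϑ then
      TreeFn.node (fun i => treeOf (h.choose i)) (Fin.last p)
    else TreeFn.mk fun _ => 0

open Classical in
/-- The action of `N_{p ^ k}` on the tree functions of irreducible characters,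
`T ^ h = 𝒯(θ ^ h)` for the irreducible character `θ` with `𝒯(θ) = T`. -/
noncomputable def treeAct {p : ℕ} [NeZero p] {k : ℕ} (h : Nor p k) (T : TreeFn p k) : TreeFn p k :=
  if hT : ∃ θ : Syl p k → ℂ, IsIrrChar θ ∧ treeOf θ = T then treeOf (conjChar h hT.choose) else T

end SylowTree

open SylowTree

/-! The argument is Clifford theory for $P_{p^{k+1}}=P_{p^k}\wr P_p$ over its base group
$B=(P_{p^k})^p$, carried out with inner products of characters. Such an inner product is the
dimension of a space of intertwiners, hence a natural number, and two functions of norm one whose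
inner product is a nonzero natural number are equal (`eq_of_charInner_eq`).

Let $\theta$ be irreducible. Its restriction to $B$ pairs nontrivially with some
$\psi_1\times\dots\times\psi_p$, the $\psi_i$ irreducible. If the $\psi_i$ are not all equal, then,
$p$ being prime, the $p$ rotations of the tuple are distinct, the induced character has norm one,
and Frobenius reciprocity makes it equal to $\theta$. If all $\psi_i$ are equal to $\varphi$, the
characters $\mathcal X(\varphi;\varepsilon)$ have norm one and add up to the induced character, so
$\theta$ is one of them. This is `IsIrrChar.classification`. The two cases exclude each other. The
tuple is determined up to rotation, and $\varphi$ by the restriction to $B$. Finally $\varepsilon$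
is determined by a nonzero value of $\theta$ outside $B$. Hence $\mathcal T$ can be computed from
any choice of parameters (`treeOf_of_isX`, `treeOf_indProd`) and is injective, which gives
admissibility and the well-definedness of the action.

It remains to conjugate. For $j<k+1$, $\sigma_j^{(k+1)}$ acts alike in all blocks and commutes with
the rotation of blocks, so it conjugates every factor and keeps $\varepsilon$. The last $\sigma$
permutes the factors and replaces $\gamma^s$ by $\gamma^{bs}$ with $b=a^{-1}$, so it permutes
subtrees by $\tau$ and multiplies $\varepsilon$ by $b$, which is the effect of $\tau$ on labels. -/

namespace SylowTree

/-! ### Orthogonality and completeness of irreducible characters of a finite group -/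

section characters

open Module ComplexConjugate ComplexOrder

/-- The Hermitian product of complex functions on a finite set. -/
noncomputable def charInner {X : Type*} [Fintype X] (α β : X → ℂ) : ℂ :=
  (Nat.card X : ℂ)⁻¹ * ∑ g, α g * conj (β g)

theorem charInner_conj_symm {X : Type*} [Fintype X] (α β : X → ℂ) :
    conj (charInner α β) = charInner β α := by
  simp [charInner, mul_comm]

theorem charInner_sum_left {X ι : Type*} [Fintype X] (s : Finset ι) (α : ι → X → ℂ) (β : X → ℂ) :
    charInner (∑ i ∈ s, α i) β = ∑ i ∈ s, charInner (α i) β := by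
  simp only [charInner, Finset.sum_apply, Finset.sum_mul, ← Finset.mul_sum]
  rw [Finset.sum_comm]

variable {G : Type*} [Group G]
variable {V : Type*} [AddCommGroup V] [Module ℂ V] [FiniteDimensional ℂ V]
variable {W : Type*} [AddCommGroup W] [Module ℂ W] [FiniteDimensional ℂ W]

/-- `IsIrrChar` only allows the spaces `Fin n → ℂ`; a basis transports `ρ` there together with its
lattice of subrepresentations. -/
theorem isIrrChar_character (ρ : Representation ℂ G V) (h : ρ.IsIrreducible) :
    IsIrrChar ρ.character := by
  let e : V ≃ₗ[ℂ] (Fin (finrank ℂ V) → ℂ) := (finBasis ℂ V).equivFun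
  let ρ' : Representation ℂ G (Fin (finrank ℂ V) → ℂ) :=
    (e.conjAlgEquiv ℂ : _ →* _).comp ρ
  have he : ∀ g v, ρ' g (e v) = e (ρ g v) := fun g v => by
    simp [ρ']
  let E : ρ.Equiv ρ' := Representation.Equiv.mk e fun g => by ext v; simp [he]
  refine ⟨_, ρ', ?_, (Representation.char_iso E).symm⟩
  let o : Subrepresentation ρ ≃o Subrepresentation ρ' :=
    { toFun := fun N => ⟨N.toSubmodule.map e.toLinearMap, by
        rintro g _ ⟨v, hv, rfl⟩
        exact ⟨ρ g v, N.apply_mem_toSubmodule g hv, (he g v).symm⟩⟩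
      invFun := fun N => ⟨N.toSubmodule.comap e.toLinearMap, fun g v hv => by
        have := N.apply_mem_toSubmodule g hv
        simpa [he] using this⟩
      left_inv := fun N => Subrepresentation.ext
        (Submodule.comap_map_eq_of_injective e.injective _)
      right_inv := fun N => Subrepresentation.ext
        (Submodule.map_comap_eq_of_surjective e.surjective _)
      map_rel_iff' := fun {N N'} => by
        change N.toSubmodule.map e.toLinearMap ≤ N'.toSubmodule.map e.toLinearMap ↔ _
        rw [Submodule.map_le_map_iff_of_injective e.injective]
        rfl }
  exact (OrderIso.isSimpleOrder_iff o).1 h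

theorem character_eq_add_of_isCompl (ρ : Representation ℂ G V) (N N' : Subrepresentation ρ)
    (h : IsCompl N.toSubmodule N'.toSubmodule) :
    ρ.character = N.toRepresentation.character + N'.toRepresentation.character := by
  funext g
  have hi : DirectSum.IsInternal fun b : Bool => cond b N.toSubmodule N'.toSubmodule := by
    rw [DirectSum.isInternal_submodule_iff_isCompl _ (i := true) (j := false) (by simp)]
    · exact h
    · ext b; cases b <;> simp
  have := LinearMap.trace_eq_sum_trace_restrict hi (f := ρ g) (by
    rintro (_ | _)
    · exact N'.apply_mem_toSubmodule g
    · exact N.apply_mem_toSubmodule g)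
  rw [Fintype.sum_bool] at this
  exact this

variable [Fintype G]

/-- The invariant Hermitian form makes `ρ g⁻¹` similar to the adjoint of `ρ g`. -/
theorem character_inv (ρ : Representation ℂ G V) (g : G) :
    ρ.character g⁻¹ = conj (ρ.character g) := by
  classical
  let b := Module.finBasis ℂ V
  let A : G → Matrix _ _ ℂ := fun g => LinearMap.toMatrix b b (ρ g)
  have hmul : ∀ g h, A (g * h) = A g * A h := fun g h => by
    simp only [A, map_mul]; exact LinearMap.toMatrix_mul b _ _
  have hone : A 1 = 1 := by simp [A]
  have htr : ∀ g, ρ.character g = (A g).trace := fun g => LinearMap.trace_eq_matrix_trace ℂ b _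
  -- Averaging the standard form over the group. The summand at `1` is the identity, which makes the
  -- sum definite and hence invertible.
  let M := ∑ h, (A h).conjTranspose * A h
  have hM : M.PosDef := by
    have h1 : M = (A 1).conjTranspose * A 1 + ∑ h ∈ Finset.univ.erase 1,
        (A h).conjTranspose * A h := (Finset.add_sum_erase _ _ (Finset.mem_univ _)).symm
    rw [h1, hone]
    refine Matrix.PosDef.add_posSemidef (by simpa using Matrix.PosDef.one) ?_
    exact Matrix.posSemidef_sum _ fun h _ => Matrix.posSemidef_conjTranspose_mul_self _
  have hinv : (A g).conjTranspose * M * A g = M := by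
    simp only [M, Finset.mul_sum, Finset.sum_mul]
    refine Fintype.sum_bijective (· * g) (Group.mulRight_bijective g) _ _ fun h => ?_
    simp only [hmul, Matrix.conjTranspose_mul, mul_assoc]
  have hgg : A g * A g⁻¹ = 1 := by rw [← hmul, mul_inv_cancel, hone]
  have hu : IsUnit M.det := (Matrix.isUnit_iff_isUnit_det _).1 hM.isUnit
  have key : A g⁻¹ = M⁻¹ * ((A g).conjTranspose * M) := by
    calc A g⁻¹ = M⁻¹ * (M * A g⁻¹) := by rw [← mul_assoc, Matrix.nonsing_inv_mul _ hu, one_mul]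
      _ = M⁻¹ * (((A g).conjTranspose * M) * (A g * A g⁻¹)) := by
        rw [← mul_assoc ((A g).conjTranspose * M), hinv]
      _ = _ := by rw [hgg, mul_one]
  rw [htr, htr, key, Matrix.trace_mul_comm, mul_assoc, Matrix.mul_nonsing_inv _ hu, mul_one,
    Matrix.trace_conjTranspose]
  rfl

/-- The source of all integrality: `character_inv` turns the usual sum with $g^{-1}$ into the
Hermitian product. -/
theorem charInner_character (ρ : Representation ℂ G V) (σ : Representation ℂ G W) :
    charInner σ.character ρ.character = finrank ℂ (ρ.IntertwiningMap σ) := by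
  have : Invertible (Nat.card G : ℂ) := invertibleOfNonzero (by simp)
  rw [← Representation.card_inv_mul_sum_char_mul_char_eq_finrank]
  simp only [charInner, character_inv]

theorem IsIrrChar.charInner_self {α : G → ℂ} (hα : IsIrrChar α) : charInner α α = 1 := by
  obtain ⟨n, ρ, hρ, rfl⟩ := hα
  rw [charInner_character, Representation.IsIrreducible.finrank_intertwiningMap_self, Nat.cast_one]

open Classical in
theorem IsIrrChar.charInner_eq {α β : G → ℂ} (hα : IsIrrChar α) (hβ : IsIrrChar β) :
    charInner α β = if α = β then 1 else 0 := by
  split_ifs with h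
  · rw [← h, hα.charInner_self]
  · obtain ⟨n, ρ, hρ, rfl⟩ := hα
    obtain ⟨m, σ, hσ, rfl⟩ := hβ
    have : IsEmpty (σ.Equiv ρ) := ⟨fun e => h (Representation.char_iso e).symm⟩
    rw [charInner_character, finrank_zero_of_subsingleton, Nat.cast_zero]

/-- Norm one yields a nonzero intertwiner, irreducibility of `ρ` makes it injective, and equal
degrees make it bijective. Irreducibility of `σ` is not assumed because `IsX` supplies a
representation through its character alone. -/
theorem IsIrrChar.exists_equiv {n m : ℕ} (ρ : Representation ℂ G (Fin n → ℂ))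
    (σ : Representation ℂ G (Fin m → ℂ)) (hρ : ρ.IsIrreducible)
    (h : ρ.character = σ.character) : Nonempty (ρ.Equiv σ) := by
  have h1 := charInner_character ρ σ
  rw [← h, IsIrrChar.charInner_self ⟨n, ρ, hρ, rfl⟩] at h1
  have : Nontrivial (ρ.IntertwiningMap σ) := by
    rw [← finrank_pos_iff (R := ℂ)]
    have : finrank ℂ (ρ.IntertwiningMap σ) = 1 := by exact_mod_cast h1.symm
    omega
  obtain ⟨f, hf⟩ := exists_ne (0 : ρ.IntertwiningMap σ)
  have hinj := (Representation.IsIrreducible.injective_or_eq_zero f).resolve_right hf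
  have hdim : finrank ℂ (Fin n → ℂ) = finrank ℂ (Fin m → ℂ) := by
    have := congrFun h 1
    rw [Representation.char_one, Representation.char_one] at this
    exact_mod_cast this
  have hsurj := (LinearMap.injective_iff_surjective_of_finrank_eq_finrank (f := f.toLinearMap)
    hdim).1 hinj
  exact ⟨f.ofBijective ⟨hinj, hsurj⟩⟩

theorem exists_nat_charInner_character (ρ : Representation ℂ G V) (σ : Representation ℂ G W) :
    ∃ m : ℕ, charInner σ.character ρ.character = m := ⟨_, charInner_character ρ σ⟩

/-- Functions of norm one whose product is a nonzero natural number agree. -/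
theorem eq_of_charInner_eq {α β : G → ℂ} (hα : charInner α α = 1) (hβ : charInner β β = 1)
    {m : ℕ} (hm : m ≠ 0) (h : charInner α β = m) : α = β := by
  have h' : charInner β α = m := by rw [← charInner_conj_symm, h]; simp
  have hc : (0 : ℝ) < (Nat.card G : ℝ)⁻¹ := by
    have : 0 < Nat.card G := Nat.card_pos
    positivity
  -- This is $\|\alpha-\beta\|^2$; it is at most $0$ because $m\ge 1$.
  have key : ((Nat.card G : ℝ)⁻¹ * ∑ g, Complex.normSq (α g - β g) : ℝ) = 2 - 2 * (m : ℝ) := by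
    have : (((Nat.card G : ℝ)⁻¹ * ∑ g, Complex.normSq (α g - β g) : ℝ) : ℂ) =
        charInner α α - charInner α β - charInner β α + charInner β β := by
      push_cast
      simp only [charInner, ← mul_sub, ← mul_add, ← Finset.sum_sub_distrib,
        ← Finset.sum_add_distrib, ← Complex.mul_conj]
      congr 1
      refine Finset.sum_congr rfl fun g _ => ?_
      simp only [map_sub]
      ring
    rw [hα, hβ, h, h'] at this
    apply Complex.ofReal_injective
    rw [this]; push_cast; ring
  have h1 : (1 : ℝ) ≤ m := by exact_mod_cast Nat.one_le_iff_ne_zero.2 hm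
  have h2 : ∑ g, Complex.normSq (α g - β g) ≤ 0 := by
    by_contra hcon
    have := mul_pos hc (not_le.1 hcon)
    linarith
  funext g
  have h3 := (Finset.sum_eq_zero_iff_of_nonneg fun g _ => Complex.normSq_nonneg _).1
    (le_antisymm h2 (Finset.sum_nonneg fun g _ => Complex.normSq_nonneg _)) g (Finset.mem_univ g)
  exact sub_eq_zero.1 (Complex.normSq_eq_zero.1 h3)

theorem character_mem_span (ρ : Representation ℂ G V) :
    ρ.character ∈ Submodule.span ℂ {χ : G → ℂ | IsIrrChar χ} := by
  induction hn : finrank ℂ V using Nat.strong_induction_on generalizing V with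
  | _ n ih =>
    by_cases hV : Subsingleton V
    · have : ρ.character = 0 := by
        funext g
        have : ρ g = 0 := Subsingleton.elim _ _
        simp [Representation.character, this]
      rw [this]
      exact Submodule.zero_mem _
    rw [not_subsingleton_iff_nontrivial] at hV
    by_cases hirr : ρ.IsIrreducible
    · exact Submodule.subset_span (isIrrChar_character ρ hirr)
    have hnt : Nontrivial (Subrepresentation ρ) := by
      refine ⟨⊥, ⊤, fun h => ?_⟩
      have : (⊥ : Submodule ℂ V) = ⊤ := congrArg Subrepresentation.toSubmodule h
      exact bot_ne_top this
    obtain ⟨N, hN⟩ : ∃ N : Subrepresentation ρ, ¬ (N = ⊥ ∨ N = ⊤) := by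
      by_contra! hcon
      exact hirr ⟨fun N => or_iff_not_imp_left.2 fun h => (hcon N).resolve_left h⟩
    push Not at hN
    -- Maschke's theorem; both summands have smaller dimension.
    obtain ⟨N', hN'⟩ := exists_isCompl N
    have hc : IsCompl N.toSubmodule N'.toSubmodule := by
      constructor
      · rw [disjoint_iff]
        exact congrArg Subrepresentation.toSubmodule (disjoint_iff.1 hN'.1)
      · rw [codisjoint_iff]
        exact congrArg Subrepresentation.toSubmodule (codisjoint_iff.1 hN'.2)
    have hne1 : N.toSubmodule ≠ ⊥ := fun h => hN.1 (Subrepresentation.ext h)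
    have hne2 : N.toSubmodule ≠ ⊤ := fun h => hN.2 (Subrepresentation.ext h)
    have hsum := Submodule.finrank_add_eq_of_isCompl hc
    have hpos : 0 < finrank ℂ N.toSubmodule :=
      Nat.pos_of_ne_zero fun h => hne1 (Submodule.finrank_eq_zero.1 h)
    have hlt := Submodule.finrank_lt hne2
    rw [character_eq_add_of_isCompl ρ N N' hc]
    exact Submodule.add_mem _ (ih _ (by omega) _ rfl) (ih _ (by omega) _ rfl)

open Classical in
/-- The indicator function of the identity is a combination of irreducible characters. -/
theorem indicator_one_mem_span :
    (fun g : G => if g = 1 then (1 : ℂ) else 0) ∈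
      Submodule.span ℂ {χ : G → ℂ | IsIrrChar χ} := by
  -- The regular representation, whose character is $|G|$ times the indicator of the identity.
  let R : Representation ℂ G (G → ℂ) :=
    { toFun := fun g => LinearMap.funLeft ℂ ℂ fun x => g⁻¹ * x
      map_one' := by ext; simp [LinearMap.funLeft]
      map_mul' := fun g h => by
        apply LinearMap.ext; intro f; funext x
        simp [LinearMap.funLeft, mul_assoc] }
  have hR : R.character = (Nat.card G : ℂ) • fun g : G => if g = 1 then (1 : ℂ) else 0 := by
    funext g
    rw [Representation.character, LinearMap.trace_eq_matrix_trace ℂ (Pi.basisFun ℂ G),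
      Matrix.trace]
    have : ∀ x : G, (LinearMap.toMatrix (Pi.basisFun ℂ G) (Pi.basisFun ℂ G) (R g)).diag x =
        if g = 1 then 1 else 0 := fun x => by
      simp [R, LinearMap.funLeft, Pi.single_apply]
    simp only [this]
    simp
  have h := (Submodule.span ℂ {χ : G → ℂ | IsIrrChar χ}).smul_mem (Nat.card G : ℂ)⁻¹
    (character_mem_span R)
  rwa [hR, smul_smul, inv_mul_cancel₀ (by simp), one_smul] at h

end characters

/-! ### External products of characters on a power of a group -/

section products

open Module ComplexConjugate

theorem trace_piTensorProduct_map {ι R : Type*} [Fintype ι] [CommRing R] {M : ι → Type*}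
    [∀ i, AddCommGroup (M i)] [∀ i, Module R (M i)] [∀ i, Module.Free R (M i)]
    [∀ i, Module.Finite R (M i)] (A : ∀ i, M i →ₗ[R] M i) :
    LinearMap.trace R _ (PiTensorProduct.map A) = ∏ i, LinearMap.trace R _ (A i) := by
  classical
  let b := fun i => Module.Free.chooseBasis R (M i)
  rw [LinearMap.trace_eq_matrix_trace R (Basis.piTensorProduct b)]
  simp only [fun i => LinearMap.trace_eq_matrix_trace R (b i) (A i), Matrix.trace,
    Matrix.diag_apply]
  rw [Finset.prod_univ_sum, Fintype.piFinset_univ]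
  refine Finset.sum_congr rfl fun v _ => ?_
  simp [LinearMap.toMatrix_apply]

variable {ι H : Type*} [Group H] [Fintype ι]

/-- The external tensor product of representations of `H`, a representation of `H ^ ι`. -/
noncomputable def prodRep {n : ι → ℕ} (ρ : ∀ i, Representation ℂ H (Fin (n i) → ℂ)) :
    Representation ℂ (ι → H) (⨂[ℂ] i, (Fin (n i) → ℂ)) :=
  PiTensorProduct.mapMonoidHom.comp
    (MonoidHom.pi fun i => (ρ i : H →* _).comp (Pi.evalMonoidHom (fun _ : ι => H) i))

theorem character_prodRep {n : ι → ℕ} (ρ : ∀ i, Representation ℂ H (Fin (n i) → ℂ)) (f : ι → H) :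
    (prodRep ρ).character f = ∏ i, (ρ i).character (f i) :=
  trace_piTensorProduct_map fun i => ρ i (f i)

/-- The external product of functions. -/
noncomputable def extProd {H : Type*} (ψ : ι → H → ℂ) : (ι → H) → ℂ := fun f => ∏ i, ψ i (f i)

theorem charInner_extProd {H : Type*} [Fintype H] [DecidableEq ι] (ψ ψ' : ι → H → ℂ) :
    charInner (extProd ψ) (extProd ψ') = ∏ i, charInner (ψ i) (ψ' i) := by
  simp only [charInner, extProd, Finset.prod_mul_distrib, map_prod]
  congr 1
  · simp
  · rw [Finset.prod_univ_sum, Fintype.piFinset_univ]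
    simp only [Finset.prod_mul_distrib]

variable [Fintype H] [DecidableEq ι]

open Classical in
theorem charInner_extProd_of_isIrrChar {ψ ψ' : ι → H → ℂ} (hψ : ∀ i, IsIrrChar (ψ i))
    (hψ' : ∀ i, IsIrrChar (ψ' i)) :
    charInner (extProd ψ) (extProd ψ') = if ψ = ψ' then 1 else 0 := by
  simp only [charInner_extProd, fun i => (hψ i).charInner_eq (hψ' i), Finset.prod_ite_zero,
    Finset.prod_const_one, Finset.mem_univ, true_imp_iff, funext_iff (f := ψ)]

theorem exists_nat_charInner_extProd {V : Type*} [AddCommGroup V] [Module ℂ V]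
    [FiniteDimensional ℂ V] (ρ : Representation ℂ (ι → H) V) {ψ : ι → H → ℂ}
    (hψ : ∀ i, IsIrrChar (ψ i)) : ∃ m : ℕ, charInner ρ.character (extProd ψ) = m := by
  choose n σ _ hσ using hψ
  have : extProd ψ = (prodRep σ).character := by
    funext f
    rw [character_prodRep]
    simp only [hσ]; rfl
  rw [this]
  exact exists_nat_charInner_character _ _

/-- The pairing is conjugate-linear in each factor separately, so irreducible factors can be
replaced one at a time by elements of their span. -/
theorem sum_mul_conj_extProd_eq_zero (α : (ι → H) → ℂ)
    (h : ∀ ψ : ι → H → ℂ, (∀ i, IsIrrChar (ψ i)) → ∑ f, α f * conj (extProd ψ f) = 0)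
    (ψ : ι → H → ℂ) (hψ : ∀ i, ψ i ∈ Submodule.span ℂ {χ : H → ℂ | IsIrrChar χ}) :
    ∑ f, α f * conj (extProd ψ f) = 0 := by
  -- Here `s` is the set of coordinates already freed from being irreducible.
  suffices ∀ (s : Finset ι) (ψ : ι → H → ℂ),
      (∀ i ∈ s, ψ i ∈ Submodule.span ℂ {χ : H → ℂ | IsIrrChar χ}) →
      (∀ i ∉ s, IsIrrChar (ψ i)) → ∑ f, α f * conj (extProd ψ f) = 0 from
    this Finset.univ ψ (fun i _ => hψ i) (by simp)
  intro s
  induction s using Finset.induction_on with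
  | empty => exact fun ψ _ h' => h ψ fun i => h' i (by simp)
  | insert a s ha ih =>
    intro ψ h1 h2
    have hup : ∀ (φ : H → ℂ) f, extProd (Function.update ψ a φ) f =
        φ (f a) * ∏ i ∈ Finset.univ.erase a, ψ i (f i) := fun φ f => by
      rw [extProd, ← Finset.mul_prod_erase _ _ (Finset.mem_univ a), Function.update_self]
      congr 1
      exact Finset.prod_congr rfl fun i hi => by
        rw [Function.update_of_ne (Finset.ne_of_mem_erase hi)]
    have key : ∀ φ ∈ Submodule.span ℂ {χ : H → ℂ | IsIrrChar χ},
        ∑ f, α f * conj (extProd (Function.update ψ a φ) f) = 0 := by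
      intro φ hφ
      induction hφ using Submodule.span_induction with
      | mem φ hφ =>
        refine ih _ (fun i hi => ?_) (fun i hi => ?_)
        · rw [Function.update_of_ne (by rintro rfl; exact ha hi)]
          exact h1 i (Finset.mem_insert_of_mem hi)
        · by_cases hia : i = a
          · subst hia; simpa using hφ
          · rw [Function.update_of_ne hia]
            exact h2 i (by simp [hia, hi])
      | zero => simp [hup]
      | add φ φ' _ _ e e' =>
        simp only [hup, Pi.add_apply, add_mul, map_add, mul_add, Finset.sum_add_distrib] at e e' ⊢
        rw [e, e', add_zero]
      | smul c φ _ e =>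
        simp only [hup, Pi.smul_apply, smul_eq_mul, map_mul] at e ⊢
        calc _ = conj c *
              ∑ f, α f * (conj (φ (f a)) * conj (∏ i ∈ Finset.univ.erase a, ψ i (f i))) := by
              rw [Finset.mul_sum]
              exact Finset.sum_congr rfl fun f _ => by ring
          _ = 0 := by rw [e, mul_zero]
    have := key (ψ a) (h1 a (Finset.mem_insert_self _ _))
    rwa [Function.update_eq_self] at this

/-- A function on `H ^ ι` that does not vanish at `1` is not orthogonal to all products of
irreducible characters. -/
theorem exists_charInner_extProd_ne_zero (α : (ι → H) → ℂ) (hα : α 1 ≠ 0) :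
    ∃ ψ : ι → H → ℂ, (∀ i, IsIrrChar (ψ i)) ∧ charInner α (extProd ψ) ≠ 0 := by
  classical
  by_contra! hcon
  -- With the indicator of `1` in every factor, the product is the indicator of `1` in `H ^ ι`, and
  -- orthogonality would give `α 1 = 0`. No list of the irreducible characters of `H ^ ι` is needed.
  have h := sum_mul_conj_extProd_eq_zero α (fun ψ hψ => by
    simpa [charInner] using hcon ψ hψ) _ fun _ => indicator_one_mem_span
  simp only [extProd, Finset.prod_ite_zero, Finset.prod_const_one, Finset.mem_univ, true_imp_iff,
    apply_ite conj, map_one, map_zero] at h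
  rw [Finset.sum_eq_single 1] at h
  · simp [hα] at h
  · intro f _ hf
    rw [if_neg (show ¬ ∀ i, f i = 1 from fun h' => hf (funext h')), mul_zero]
  · simp

end products

/-! ### The group $P_{p^{k+1}}$ as a wreath product -/

section wreath

variable {p : ℕ} [NeZero p] {k : ℕ}

theorem wr_injective {f f' : Fin p → Equiv.Perm (Fin (p ^ k))} {δ δ' : Equiv.Perm (Fin p)}
    (h : wr f δ = wr f' δ') : f = f' ∧ δ = δ' := by
  have h1 : ∀ m r, (δ m, f (δ m) r) = (δ' m, f' (δ' m) r) := fun m r =>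
    Equiv.congr_fun ((blockEquiv p k).permCongr.injective h) (m, r)
  have hδ : δ = δ' := Equiv.ext fun m =>
    congrArg Prod.fst (h1 m ⟨0, Nat.pos_of_ne_zero (pow_ne_zero _ (NeZero.ne p))⟩)
  refine ⟨funext fun m => Equiv.ext fun r => ?_, hδ⟩
  have := congrArg Prod.snd (h1 (δ⁻¹ m) r)
  rw [← hδ] at this
  simpa using this

theorem rot_pow_eq_iff {s s' : ℕ} : rot p ^ s = rot p ^ s' ↔ (s : ZMod p) = s' := by
  constructor
  · intro h
    have := congrArg (fun δ => residue p (δ 0)) h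
    simpa [residue_rot_pow] using this
  · intro h
    ext1 i
    apply (residue p).injective
    rw [residue_rot_pow, residue_rot_pow, h]

theorem coe_wreath (f : Fin p → Syl p k) (s : ℕ) :
    (wreath f s : Equiv.Perm (Fin (p ^ (k + 1)))) =
      wr (fun i => (f i : Equiv.Perm (Fin (p ^ k)))) (rot p ^ s) := rfl

theorem wreath_eq_iff {f f' : Fin p → Syl p k} {s s' : ℕ} :
    wreath f s = wreath f' s' ↔ f = f' ∧ (s : ZMod p) = s' := by
  rw [← rot_pow_eq_iff]
  constructor
  · intro h
    have := congrArg Subtype.val h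
    rw [coe_wreath, coe_wreath] at this
    have := wr_injective this
    exact ⟨funext fun i => Subtype.ext (congrFun this.1 i), this.2⟩
  · rintro ⟨rfl, h⟩
    exact Subtype.ext (by rw [coe_wreath, coe_wreath, h])

theorem wreath_mul (f f' : Fin p → Syl p k) (s s' : ℕ) :
    wreath f s * wreath f' s' = wreath (fun m => f m * f' ((rot p ^ s)⁻¹ m)) (s + s') :=
  Subtype.ext (by
    rw [Subgroup.coe_mul, coe_wreath, coe_wreath, coe_wreath, wr_mul]
    simp only [Subgroup.coe_mul, pow_add (rot p)])

theorem wreath_one : wreath (1 : Fin p → Syl p k) 0 = 1 := Subtype.ext wr_one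

/-- The base group of the wreath product. -/
def wreathBase (p : ℕ) [NeZero p] (k : ℕ) : (Fin p → Syl p k) →* Syl p (k + 1) where
  toFun f := wreath f 0
  map_one' := wreath_one
  map_mul' f f' := by rw [wreath_mul]; simp; rfl

theorem exists_wreath (g : Syl p (k + 1)) : ∃ (f : Fin p → Syl p k) (s : ℕ),
    wreath f s = g := by
  have key : ∀ x ∈ Syl p (k + 1), ∃ f : Fin p → Syl p k, ∃ δ ∈ Subgroup.zpowers (rot p),
      x = wr (fun i => (f i : Equiv.Perm _)) δ := by
    intro x hx
    induction hx using Subgroup.closure_induction with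
    | mem x hx =>
      obtain ⟨j, rfl⟩ := hx
      induction j using Fin.lastCases with
      | last => exact ⟨1, rot p, Subgroup.mem_zpowers _, by simp [gen]; rfl⟩
      | cast j =>
        refine ⟨Pi.mulSingle 0 ⟨gen p k j, Subgroup.subset_closure ⟨j, rfl⟩⟩, 1,
          Subgroup.one_mem _, ?_⟩
        simp only [gen, Fin.lastCases_castSucc]
        congr 1
        funext i
        by_cases hi : i = 0
        · subst hi; simp
        · simp [Pi.mulSingle_eq_of_ne hi]
    | one => exact ⟨1, 1, Subgroup.one_mem _, wr_one.symm⟩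
    | mul x y _ _ hx hy =>
      obtain ⟨f, δ, hδ, rfl⟩ := hx
      obtain ⟨f', δ', hδ', rfl⟩ := hy
      exact ⟨fun m => f m * f' (δ⁻¹ m), δ * δ', Subgroup.mul_mem _ hδ hδ', wr_mul _ _ _ _⟩
    | inv x _ hx =>
      obtain ⟨f, δ, hδ, rfl⟩ := hx
      refine ⟨fun m => (f (δ m))⁻¹, δ⁻¹, Subgroup.inv_mem _ hδ, ?_⟩
      rw [inv_eq_iff_mul_eq_one, wr_mul, ← wr_one]
      congr 1
      · funext m; simp
      · simp
  obtain ⟨f, δ, hδ, hg⟩ := key g g.2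
  obtain ⟨s, rfl⟩ := (mem_powers_iff_mem_zpowers (x := rot p)).2 hδ
  exact ⟨f, s, Subtype.ext hg.symm⟩

/-- The decomposition of `P_{p ^ (k + 1)}` as a wreath product. -/
noncomputable def wreathEquiv (p : ℕ) [NeZero p] (k : ℕ) :
    (Fin p → Syl p k) × ZMod p ≃ Syl p (k + 1) :=
  Equiv.ofBijective (fun x => wreath x.1 x.2.val) ⟨by
    rintro ⟨f, s⟩ ⟨f', s'⟩ h
    obtain ⟨rfl, hs⟩ := wreath_eq_iff.1 h
    rw [ZMod.natCast_zmod_val, ZMod.natCast_zmod_val] at hs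
    exact Prod.ext rfl hs, fun g => by
    obtain ⟨f, s, rfl⟩ := exists_wreath g
    exact ⟨(f, s), wreath_eq_iff.2 ⟨rfl, by simp⟩⟩⟩

theorem wreathEquiv_apply (f : Fin p → Syl p k) (s : ZMod p) :
    wreathEquiv p k (f, s) = wreath f s.val := rfl

noncomputable instance : Fintype (Syl p k) := Fintype.ofFinite _

theorem sum_syl_succ {M : Type*} [AddCommMonoid M] (F : Syl p (k + 1) → M) :
    ∑ g, F g = ∑ s : ZMod p, ∑ f : Fin p → Syl p k, F (wreath f s.val) := by
  rw [← (wreathEquiv p k).sum_comp, Fintype.sum_prod_type_right]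
  rfl

theorem card_syl_succ : (Nat.card (Syl p (k + 1)) : ℂ) = p * Nat.card (Fin p → Syl p k) := by
  rw [← Nat.card_congr (wreathEquiv p k), Nat.card_prod]
  simp [mul_comm]

/-- The cosets of the base group contribute separately: induced characters live on the trivial
coset, and the characters $\mathcal X(\varphi;\varepsilon)$ with the same $\varphi$ differ only on
the others. -/
theorem charInner_syl_succ (α β : Syl p (k + 1) → ℂ) :
    charInner α β = (p : ℂ)⁻¹ * ∑ s : ZMod p,
      charInner (fun f : Fin p → Syl p k => α (wreath f s.val)) fun f => β (wreath f s.val) := by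
  rw [charInner, sum_syl_succ, card_syl_succ]
  simp only [charInner, ← Finset.mul_sum, mul_inv, mul_assoc]

theorem funext_wreath {α : Type*} {F F' : Syl p (k + 1) → α}
    (h : ∀ f (s : ℕ), F (wreath f s) = F' (wreath f s)) : F = F' := by
  funext g
  obtain ⟨f, s, rfl⟩ := exists_wreath g
  exact h f s

end wreath

/-! ### The wreath product acting on a tensor power -/

section tensor

variable {p n : ℕ} {G : Type*} [Group G]

theorem tensorAct_tprod (ρ : Representation ℂ G (Fin n → ℂ)) (f : Fin p → G)
    (δ : Equiv.Perm (Fin p)) (v : Fin p → Fin n → ℂ) :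
    tensorAct ρ f δ (PiTensorProduct.tprod ℂ v) =
      PiTensorProduct.tprod ℂ fun i => ρ (f i) (v (δ⁻¹ i)) := by
  rw [tensorAct, LinearMap.comp_apply, LinearEquiv.coe_coe, PiTensorProduct.reindex_tprod,
    PiTensorProduct.map_tprod]
  rfl

theorem tensorAct_mul (ρ : Representation ℂ G (Fin n → ℂ)) (f f' : Fin p → G)
    (δ δ' : Equiv.Perm (Fin p)) :
    tensorAct ρ f δ * tensorAct ρ f' δ' =
      tensorAct ρ (fun m => f m * f' (δ⁻¹ m)) (δ * δ') := by
  apply PiTensorProduct.ext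
  refine MultilinearMap.ext fun v => ?_
  simp [tensorAct_tprod]

theorem tensorAct_one (ρ : Representation ℂ G (Fin n → ℂ)) :
    tensorAct ρ (1 : Fin p → G) 1 = 1 := by
  apply PiTensorProduct.ext
  refine MultilinearMap.ext fun v => ?_
  simp [tensorAct_tprod]

theorem trace_tensorAct_one (ρ : Representation ℂ G (Fin n → ℂ)) (f : Fin p → G) :
    LinearMap.trace ℂ _ (tensorAct ρ f 1) = ∏ i, ρ.character (f i) := by
  have : tensorAct ρ f 1 = PiTensorProduct.map fun i => ρ (f i) := by
    apply PiTensorProduct.ext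
    refine MultilinearMap.ext fun v => ?_
    simp [tensorAct_tprod]
  rw [this, trace_piTensorProduct_map]
  rfl

/-- Permuting the tensor factors by any `σ`, even outside the rotation group, is an invertible
operator, and conjugation by it preserves the trace. -/
theorem trace_tensorAct_conj (ρ : Representation ℂ G (Fin n → ℂ)) (f : Fin p → G)
    (δ σ : Equiv.Perm (Fin p)) :
    LinearMap.trace ℂ _ (tensorAct ρ (fun m => f (σ m)) (σ⁻¹ * δ * σ)) =
      LinearMap.trace ℂ _ (tensorAct ρ f δ) := by
  have : tensorAct ρ (fun m => f (σ m)) (σ⁻¹ * δ * σ) =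
      tensorAct ρ 1 σ⁻¹ * (tensorAct ρ f δ * tensorAct ρ 1 σ) := by
    simp [tensorAct_mul, mul_assoc]
  rw [this, LinearMap.trace_mul_comm, mul_assoc, tensorAct_mul ρ 1 1]
  have h1 : tensorAct ρ (fun m : Fin p => (1 : Fin p → G) m * (1 : Fin p → G) (σ⁻¹ m))
      (σ * σ⁻¹) = 1 := by
    rw [mul_inv_cancel, ← tensorAct_one ρ]
    congr 1
    funext m; simp
  rw [h1, mul_one]

/-- It follows that $\mathcal X(\varphi;\varepsilon)$ does not depend on the representation chosen
to afford $\varphi$. -/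
theorem trace_tensorAct_equiv {m : ℕ} {ρ : Representation ℂ G (Fin n → ℂ)}
    {σ : Representation ℂ G (Fin m → ℂ)} (e : ρ.Equiv σ) (f : Fin p → G)
    (δ : Equiv.Perm (Fin p)) :
    LinearMap.trace ℂ _ (tensorAct ρ f δ) = LinearMap.trace ℂ _ (tensorAct σ f δ) := by
  let E : (⨂[ℂ] _ : Fin p, (Fin n → ℂ)) ≃ₗ[ℂ] ⨂[ℂ] _ : Fin p, (Fin m → ℂ) :=
    PiTensorProduct.congr fun _ => e.toLinearEquiv
  have he : ∀ g v, e.toLinearEquiv (ρ g v) = σ g (e.toLinearEquiv v) := fun g v =>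
    e.toIntertwiningMap.isIntertwining _ _ g v
  rw [← LinearMap.trace_conj' (tensorAct ρ f δ) E]
  congr 1
  apply PiTensorProduct.ext
  refine MultilinearMap.ext fun v => ?_
  simp only [LinearMap.compMultilinearMap_apply, LinearEquiv.conj_apply_apply, E,
    PiTensorProduct.congr_symm_tprod, tensorAct_tprod, PiTensorProduct.congr_tprod, he,
    LinearEquiv.apply_symm_apply]

end tensor

/-! ### Representations affording $\mathcal X(\varphi;\varepsilon)$ -/

section xRep

variable {p : ℕ} [NeZero p] {k n : ℕ}

theorem isPrimitiveRoot_omega : IsPrimitiveRoot (omega p) p :=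
  Complex.isPrimitiveRoot_exp p (NeZero.ne p)

theorem omega_pow_eq_iff {s s' : ℕ} : omega p ^ s = omega p ^ s' ↔ (s : ZMod p) = s' := by
  have h0 : omega p ≠ 0 := Complex.exp_ne_zero _
  rw [ZMod.natCast_eq_natCast_iff, ← Units.val_mk0 h0, ← Units.val_pow_eq_pow_val,
    ← Units.val_pow_eq_pow_val, Units.val_inj, pow_eq_pow_iff_modEq, ← orderOf_units,
    Units.val_mk0, ← (isPrimitiveRoot_omega (p := p)).eq_orderOf]

/-- The operator by which an element of the wreath product acts in `xRep`. -/
noncomputable def xAct (ρ : Representation ℂ (Syl p k) (Fin n → ℂ)) (ε : Fin p)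
    (g : Syl p (k + 1)) :
    (⨂[ℂ] _ : Fin p, (Fin n → ℂ)) →ₗ[ℂ] ⨂[ℂ] _ : Fin p, (Fin n → ℂ) :=
  omega p ^ ((ε : ℕ) * ((wreathEquiv p k).symm g).2.val) •
    tensorAct ρ ((wreathEquiv p k).symm g).1 (rot p ^ ((wreathEquiv p k).symm g).2.val)

/-- `xAct` uses the reduced exponent of the rotation; any other exponent serves as well because both
`omega p` and `rot p` depend on it only modulo `p`. -/
theorem xAct_wreath (ρ : Representation ℂ (Syl p k) (Fin n → ℂ)) (ε : Fin p)
    (f : Fin p → Syl p k) (s : ℕ) :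
    xAct ρ ε (wreath f s) = omega p ^ ((ε : ℕ) * s) • tensorAct ρ f (rot p ^ s) := by
  have h := (wreathEquiv p k).apply_symm_apply (wreath f s)
  obtain ⟨⟨f', s'⟩, h'⟩ : ∃ x, x = (wreathEquiv p k).symm (wreath f s) := ⟨_, rfl⟩
  rw [← h', wreathEquiv_apply, wreath_eq_iff] at h
  obtain ⟨rfl, h⟩ := h
  rw [xAct, ← h', rot_pow_eq_iff.2 h]
  congr 1
  rw [omega_pow_eq_iff]
  push_cast
  rw [h]

/-- The representation affording `𝒳(φ; ε)`, where `ρ` affords `φ`. -/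
noncomputable def xRep (ρ : Representation ℂ (Syl p k) (Fin n → ℂ)) (ε : Fin p) :
    Representation ℂ (Syl p (k + 1)) (⨂[ℂ] _ : Fin p, (Fin n → ℂ)) where
  toFun := xAct ρ ε
  map_one' := by
    rw [← wreath_one, xAct_wreath]
    simp [tensorAct_one]
  map_mul' g g' := by
    obtain ⟨f, s, rfl⟩ := exists_wreath g
    obtain ⟨f', s', rfl⟩ := exists_wreath g'
    rw [wreath_mul, xAct_wreath, xAct_wreath, xAct_wreath, smul_mul_smul_comm, tensorAct_mul,
      ← pow_add, ← pow_add, mul_add]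

theorem character_xRep (ρ : Representation ℂ (Syl p k) (Fin n → ℂ)) (ε : Fin p)
    (f : Fin p → Syl p k) (s : ℕ) :
    (xRep ρ ε).character (wreath f s) =
      LinearMap.trace ℂ _ (tensorAct ρ f (rot p ^ s)) * omega p ^ ((ε : ℕ) * s) := by
  change LinearMap.trace ℂ _ (xAct ρ ε (wreath f s)) = _
  rw [xAct_wreath, map_smul, smul_eq_mul, mul_comm]

end xRep

/-! ### Characters induced from the base group -/

section induced

open ComplexConjugate

variable {p : ℕ} [NeZero p] {k : ℕ}

theorem IsIrrChar.apply_conj {G : Type*} [Group G] {χ : G → ℂ} (h : IsIrrChar χ) (x y : G) :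
    χ (x⁻¹ * y * x) = χ y := by
  obtain ⟨n, ρ, _, rfl⟩ := h
  have := ρ.char_conj y x⁻¹
  rwa [inv_inv] at this

theorem extProd_comp_perm {ι H : Type*} [Fintype ι] (ψ : ι → H → ℂ) (f : ι → H)
    (δ : Equiv.Perm ι) : extProd ψ (fun i => f (δ i)) = extProd (fun i => ψ (δ⁻¹ i)) f := by
  rw [extProd, extProd, ← Equiv.prod_comp δ fun i => ψ (δ⁻¹ i) (f i)]
  simp

theorem wreath_eq_conj_iff (f h u : Fin p → Syl p k) (r s : ℕ) :
    wreath h 0 = (wreath u r)⁻¹ * wreath f s * wreath u r ↔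
      (s : ZMod p) = 0 ∧
        h = fun i => (u ((rot p ^ r) i))⁻¹ * f ((rot p ^ r) i) * u ((rot p ^ r) i) := by
  rw [mul_assoc, eq_inv_mul_iff_mul_eq, wreath_mul, wreath_mul, wreath_eq_iff, and_comm]
  rw [Nat.cast_add, Nat.cast_add, Nat.cast_zero, add_comm (s : ZMod p), add_left_cancel_iff,
    eq_comm (a := (0 : ZMod p))]
  refine and_congr_right fun hs => ?_
  have h0 : rot p ^ s = 1 := by
    rw [← pow_zero (rot p), rot_pow_eq_iff]; simpa using hs
  simp only [h0, inv_one, Equiv.Perm.one_apply]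
  constructor
  · intro H
    funext i
    have := congrFun H ((rot p ^ r) i)
    simp only [Equiv.Perm.coe_inv, Equiv.symm_apply_apply] at this
    rw [mul_assoc, ← this, inv_mul_cancel_left]
  · rintro rfl
    funext m
    simp only [Equiv.Perm.coe_inv, Equiv.apply_symm_apply, mul_assoc, mul_inv_cancel_left]

/-- The base group is normal, so the induced character vanishes outside it. Inside, conjugation by
`wreath u r` rotates the factors by `r`, while `u` has no effect on class functions, and the sum
over `u` cancels the order of the base group. -/
theorem indProd_wreath {ϑ : Fin p → Syl p k → ℂ} (hϑ : ∀ i, IsIrrChar (ϑ i))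
    (f : Fin p → Syl p k) (s : ℕ) :
    indProd ϑ (wreath f s) = if (s : ZMod p) = 0 then
      ∑ r : ZMod p, extProd (fun i => ϑ ((rot p ^ r.val)⁻¹ i)) f else 0 := by
  classical
  have key : indProd ϑ (wreath f s) = (Nat.card (Fin p → Syl p k) : ℂ)⁻¹ *
      ∑ x : Syl p (k + 1), ∑ h : Fin p → Syl p k,
        if wreath h 0 = x⁻¹ * wreath f s * x then extProd ϑ h else 0 := by
    unfold indProd indChar
    congr 1
    refine Finset.sum_congr rfl fun x _ => ?_
    refine Finset.sum_congr (by ext; simp) fun h _ => ?_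
    congr 1
  rw [key, sum_syl_succ]
  simp only [wreath_eq_conj_iff]
  split_ifs with hs
  · simp only [hs, true_and, Finset.sum_ite_eq', Finset.mem_univ, if_true]
    have : ∀ (r : ZMod p) (u : Fin p → Syl p k), extProd ϑ (fun i =>
        (u ((rot p ^ r.val) i))⁻¹ * f ((rot p ^ r.val) i) * u ((rot p ^ r.val) i)) =
        extProd (fun i => ϑ ((rot p ^ r.val)⁻¹ i)) f := fun r u => by
      rw [← extProd_comp_perm]
      exact Finset.prod_congr rfl fun i _ => (hϑ i).apply_conj _ _
    simp only [this, Finset.sum_const, nsmul_eq_mul, ← Finset.mul_sum]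
    rw [← mul_assoc, Finset.card_univ, ← Nat.card_eq_fintype_card, inv_mul_cancel₀, one_mul]
    exact_mod_cast Nat.card_pos.ne'
  · simp [hs]

theorem charInner_indProd {ϑ : Fin p → Syl p k → ℂ} (hϑ : ∀ i, IsIrrChar (ϑ i))
    (α : Syl p (k + 1) → ℂ) :
    charInner α (indProd ϑ) = (p : ℂ)⁻¹ * ∑ r : ZMod p,
      charInner (fun f : Fin p → Syl p k => α (wreath f 0))
        (extProd fun i => ϑ ((rot p ^ r.val)⁻¹ i)) := by
  rw [charInner_syl_succ]
  congr 1
  rw [Finset.sum_eq_single 0]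
  · simp only [indProd_wreath hϑ, ZMod.val_zero, Nat.cast_zero, if_true, charInner, map_sum,
      Finset.mul_sum]
    rw [Finset.sum_comm]
  · intro s _ hs
    simp [indProd_wreath hϑ, hs, charInner]
  · simp

theorem wreath_comp_rot_pow (f : Fin p → Syl p k) (r : ℕ) :
    wreath (fun i => f ((rot p ^ r) i)) 0 = (wreath 1 r)⁻¹ * wreath f 0 * wreath 1 r := by
  rw [wreath_eq_conj_iff]
  simp

/-- Frobenius reciprocity: as `θ` is a class function, all `p` rotations of `ϑ` have the same
product with its restriction. -/
theorem IsIrrChar.charInner_indProd {θ : Syl p (k + 1) → ℂ} (hθ : IsIrrChar θ)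
    {ϑ : Fin p → Syl p k → ℂ} (hϑ : ∀ i, IsIrrChar (ϑ i)) :
    charInner θ (indProd ϑ) =
      charInner (fun f : Fin p → Syl p k => θ (wreath f 0)) (extProd ϑ) := by
  rw [SylowTree.charInner_indProd hϑ]
  have : ∀ r : ZMod p, charInner (fun f : Fin p → Syl p k => θ (wreath f 0))
      (extProd fun i => ϑ ((rot p ^ r.val)⁻¹ i)) =
      charInner (fun f : Fin p → Syl p k => θ (wreath f 0)) (extProd ϑ) := fun r => by
    unfold charInner
    congr 1
    refine Fintype.sum_equiv ((rot p ^ r.val).symm.arrowCongr (Equiv.refl _)) _ _ fun f => ?_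
    have h1 : ((rot p ^ r.val).symm.arrowCongr (Equiv.refl _)) f =
      fun i => f ((rot p ^ r.val) i) := rfl
    rw [h1]
    beta_reduce
    rw [wreath_comp_rot_pow, hθ.apply_conj, extProd_comp_perm]
  simp only [this, Finset.sum_const, Finset.card_univ, ZMod.card, nsmul_eq_mul]
  rw [inv_mul_cancel_left₀ (by exact_mod_cast NeZero.ne p)]

open Classical in
theorem charInner_indProd_indProd {ϑ ϑ' : Fin p → Syl p k → ℂ} (hϑ : ∀ i, IsIrrChar (ϑ i))
    (hϑ' : ∀ i, IsIrrChar (ϑ' i)) :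
    charInner (indProd ϑ) (indProd ϑ') = (p : ℂ)⁻¹ * ∑ r : ZMod p, ∑ r' : ZMod p,
      if (fun i => ϑ ((rot p ^ r'.val)⁻¹ i)) = (fun i => ϑ' ((rot p ^ r.val)⁻¹ i))
      then 1 else 0 := by
  rw [charInner_indProd hϑ']
  congr 1
  refine Finset.sum_congr rfl fun r _ => ?_
  have : (fun f : Fin p → Syl p k => indProd ϑ (wreath f 0)) =
      ∑ r' : ZMod p, extProd fun i => ϑ ((rot p ^ r'.val)⁻¹ i) := by
    funext f
    simp [indProd_wreath hϑ]
  rw [this, charInner_sum_left]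
  exact Finset.sum_congr rfl fun r' _ =>
    charInner_extProd_of_isIrrChar (fun _ => hϑ _) fun _ => hϑ' _

theorem exists_eq_comp_of_indProd_eq {ϑ ϑ' : Fin p → Syl p k → ℂ} (hϑ : ∀ i, IsIrrChar (ϑ i))
    (hϑ' : ∀ i, IsIrrChar (ϑ' i)) (h : charInner (indProd ϑ) (indProd ϑ') ≠ 0) :
    ∃ δ ∈ Subgroup.zpowers (rot p), ∀ i, ϑ i = ϑ' (δ i) := by
  classical
  rw [charInner_indProd_indProd hϑ hϑ'] at h
  obtain ⟨r, _, h⟩ := Finset.exists_ne_zero_of_sum_ne_zero (right_ne_zero_of_mul h)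
  obtain ⟨r', _, h⟩ := Finset.exists_ne_zero_of_sum_ne_zero h
  have h' : (fun i => ϑ ((rot p ^ r'.val)⁻¹ i)) = (fun i => ϑ' ((rot p ^ r.val)⁻¹ i)) := by
    by_contra hne; rw [if_neg hne] at h; exact h rfl
  refine ⟨(rot p ^ r.val)⁻¹ * rot p ^ r'.val, Subgroup.mul_mem _ (Subgroup.inv_mem _
    (Subgroup.npow_mem_zpowers _ _)) (Subgroup.npow_mem_zpowers _ _), fun i => ?_⟩
  have := congrFun h' ((rot p ^ r'.val) i)
  simpa using this

end induced

/-! ### Irreducible characters of the wreath product and their parameters -/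

section classification

variable {p : ℕ} [Fact p.Prime] {k : ℕ}

/-- For `p` prime, a nonzero `t` is invertible modulo `p`, so the powers of `rot p ^ t` act
transitively. -/
theorem eq_of_comp_rot_pow {α : Type*} {F : Fin p → α} {t : ℕ} (ht : (t : ZMod p) ≠ 0)
    (h : ∀ i, F ((rot p ^ t) i) = F i) (i j : Fin p) : F i = F j := by
  have hn : ∀ n : ℕ, ∀ i, F ((rot p ^ (t * n)) i) = F i := by
    intro n
    induction n with
    | zero => simp
    | succ n ih => intro i; rw [mul_add, mul_one, pow_add, Equiv.Perm.mul_apply, ih, h]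
  rw [← hn ((t : ZMod p)⁻¹ * (residue p j - residue p i)).val i]
  congr 1
  apply (residue p).injective
  rw [residue_rot_pow]
  push_cast
  rw [ZMod.natCast_zmod_val, mul_inv_cancel_left₀ ht]
  ring

/-- A nonconstant tuple has pairwise distinct rotations, so only the `p` diagonal terms of the
double sum survive. -/
theorem charInner_indProd_self {ϑ : Fin p → Syl p k → ℂ} (hϑ : ∀ i, IsIrrChar (ϑ i))
    (hne : ∃ i j, ϑ i ≠ ϑ j) : charInner (indProd ϑ) (indProd ϑ) = 1 := by
  classical
  have : ∀ r r' : ZMod p, (fun i => ϑ ((rot p ^ r'.val)⁻¹ i)) =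
      (fun i => ϑ ((rot p ^ r.val)⁻¹ i)) ↔ r = r' := by
    intro r r'
    refine ⟨fun h => ?_, fun h => by rw [h]⟩
    by_contra hrr
    obtain ⟨i, j, hij⟩ := hne
    refine hij (eq_of_comp_rot_pow (t := (r' - r).val) ?_ (fun i => ?_) i j)
    · rw [ZMod.natCast_zmod_val, sub_ne_zero]; exact fun h => hrr h.symm
    · have h1 := congrFun h ((rot p ^ r'.val) i)
      simp only [Equiv.Perm.coe_inv, Equiv.symm_apply_apply] at h1
      rw [h1]
      congr 1
      rw [Equiv.eq_symm_apply, ← Equiv.Perm.mul_apply, ← pow_add]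
      congr 1
      rw [rot_pow_eq_iff]
      push_cast
      simp
  rw [charInner_indProd_indProd hϑ hϑ]
  simp only [this, Finset.sum_ite_eq, Finset.mem_univ, if_true, Finset.sum_const, Finset.card_univ,
    ZMod.card, nsmul_eq_mul, mul_one]
  exact inv_mul_cancel₀ (by exact_mod_cast NeZero.ne p)

theorem sum_omega_pow (s : ℕ) :
    ∑ ε : Fin p, omega p ^ ((ε : ℕ) * s) = if (s : ZMod p) = 0 then (p : ℂ) else 0 := by
  have h1 : ∑ ε : Fin p, omega p ^ ((ε : ℕ) * s) = ∑ i ∈ Finset.range p, (omega p ^ s) ^ i := by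
    rw [← Fin.sum_univ_eq_sum_range (fun i => (omega p ^ s) ^ i)]
    exact Finset.sum_congr rfl fun i _ => by rw [mul_comm, pow_mul]
  rw [h1]
  split_ifs with hs
  · have : omega p ^ s = 1 := by
      rw [← pow_zero (omega p), omega_pow_eq_iff]; simpa using hs
    simp [this]
  · have hne : omega p ^ s ≠ 1 := by
      rw [← pow_zero (omega p), Ne, omega_pow_eq_iff]; simpa using hs
    have h2 := mul_geom_sum (omega p ^ s) p
    rw [← pow_mul, mul_comm s, pow_mul, isPrimitiveRoot_omega.pow_eq_one, one_pow, sub_self] at h2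
    exact (mul_eq_zero.1 h2).resolve_left (sub_ne_zero.2 hne)

/-- A representation whose restriction has a character of norm one has a character of norm one. -/
theorem charInner_character_self_of_comp {G H V : Type*} [Group G] [Fintype G] [Group H]
    [Fintype H] [AddCommGroup V] [Module ℂ V] [FiniteDimensional ℂ V] (ρ : Representation ℂ G V)
    (i : H →* G) (h : charInner (Representation.character (V := V) (k := ℂ) ((ρ : _ →* _).comp i))
      (Representation.character (V := V) (k := ℂ) ((ρ : _ →* _).comp i)) = 1) :
    charInner ρ.character ρ.character = 1 := by
  let B : Representation ℂ H V := (ρ : _ →* _).comp i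
  have hone : Module.finrank ℂ (B.IntertwiningMap B) = 1 := by
    rw [charInner_character] at h
    exact_mod_cast h
  -- Endomorphisms of `ρ` are endomorphisms of its restriction, which form a line; the identity is
  -- nonzero since the space is.
  let F : ρ.IntertwiningMap ρ →ₗ[ℂ] B.IntertwiningMap B :=
    { toFun := fun φ => ⟨φ.toLinearMap, fun f => φ.isIntertwining' _⟩
      map_add' := fun _ _ => rfl
      map_smul' := fun _ _ => rfl }
  have hF : Function.Injective F := fun φ ψ h =>
    Representation.IntertwiningMap.ext (congrArg (fun x => x.toLinearMap) h)
  have hle := LinearMap.finrank_le_finrank_of_injective hF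
  have hpos : 0 < Module.finrank ℂ (ρ.IntertwiningMap ρ) := by
    refine Module.finrank_pos_iff_exists_ne_zero.2
      ⟨Representation.IntertwiningMap.id _, fun h => ?_⟩
    obtain ⟨φ, hφ⟩ := Module.finrank_pos_iff_exists_ne_zero.1 (by omega :
      0 < Module.finrank ℂ (B.IntertwiningMap B))
    refine hφ (Representation.IntertwiningMap.ext (LinearMap.ext fun v => ?_))
    have hv : v = 0 := congrArg (fun x => x.toLinearMap v) h
    rw [hv, map_zero, map_zero]
  rw [charInner_character, le_antisymm (hle.trans hone.le) hpos, Nat.cast_one]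

theorem charInner_xRep_self {n : ℕ} (ρ : Representation ℂ (Syl p k) (Fin n → ℂ))
    (hρ : ρ.IsIrreducible) (ε : Fin p) :
    charInner (xRep ρ ε).character (xRep ρ ε).character = 1 := by
  let B : Representation ℂ (Fin p → Syl p k) _ := (xRep ρ ε : _ →* _).comp (wreathBase p k)
  have hB : B.character = extProd fun _ => ρ.character := by
    funext f
    refine (character_xRep ρ ε f 0).trans ?_
    rw [pow_zero, trace_tensorAct_one]
    simp [extProd]
  refine charInner_character_self_of_comp (xRep ρ ε) (wreathBase p k) ?_
  change charInner B.character B.character = 1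
  rw [hB, charInner_extProd]
  simp only [IsIrrChar.charInner_self ⟨n, ρ, hρ, rfl⟩, Finset.prod_const_one]

/-- Summing over `ε` multiplies the character by `p` on the base group and by `0` elsewhere, which
gives the character induced from $\varphi\times\dots\times\varphi$; this is reciprocity for a
constant tuple. -/
theorem charInner_sum_xRep {n : ℕ} (ρ : Representation ℂ (Syl p k) (Fin n → ℂ))
    (α : Syl p (k + 1) → ℂ) :
    ∑ ε : Fin p, charInner α (xRep ρ ε).character =
      charInner (fun f : Fin p → Syl p k => α (wreath f 0)) (extProd fun _ => ρ.character) := by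
  have h : ∑ ε : Fin p, charInner α (xRep ρ ε).character =
      charInner α (∑ ε : Fin p, (xRep ρ ε).character) := by
    rw [← charInner_conj_symm, charInner_sum_left, map_sum]
    simp only [charInner_conj_symm]
  rw [h, charInner_syl_succ, Finset.sum_eq_single 0]
  · have hp : (p : ℂ) ≠ 0 := by exact_mod_cast NeZero.ne p
    simp only [Finset.sum_apply, character_xRep, ← Finset.mul_sum, sum_omega_pow]
    simp only [ZMod.val_zero, Nat.cast_zero, if_true, pow_zero, trace_tensorAct_one, charInner,
      map_mul, map_natCast, ← mul_assoc, ← Finset.sum_mul]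
    rw [mul_comm, ← mul_assoc, ← mul_assoc, mul_inv_cancel₀ hp, one_mul]
    rfl
  · intro s _ hs
    simp only [Finset.sum_apply, character_xRep, ← Finset.mul_sum, sum_omega_pow]
    simp [hs, charInner]
  · simp

/-- Every irreducible character of `P_{p ^ k} ≀ P_p` is of the form `𝒳(φ; ε)` or induced from a
product of irreducible characters that are not all equal. -/
theorem IsIrrChar.classification {θ : Syl p (k + 1) → ℂ} (hθ : IsIrrChar θ) :
    (∃ (φ : Syl p k → ℂ) (ε : Fin p), IsIrrChar φ ∧ IsX φ ε θ) ∨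
    ∃ ϑ : Fin p → Syl p k → ℂ, (∀ i, IsIrrChar (ϑ i)) ∧ (∃ i j, ϑ i ≠ ϑ j) ∧ θ = indProd ϑ := by
  obtain ⟨N, ρ, hρ, rfl⟩ := hθ
  have hθ : IsIrrChar ρ.character := ⟨N, ρ, hρ, rfl⟩
  let B : Representation ℂ (Fin p → Syl p k) _ := (ρ : _ →* _).comp (wreathBase p k)
  have hB : B.character = fun f => ρ.character (wreath f 0) := rfl
  obtain ⟨ψ, hψ, hne⟩ := exists_charInner_extProd_ne_zero B.character (by
    rw [Representation.char_one]
    intro h0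
    have h1 := hθ.charInner_self
    have h2 : Module.finrank ℂ (Fin N → ℂ) = 0 := by exact_mod_cast h0
    have h3 : ρ.character = 0 := by
      funext g
      have := Module.finrank_zero_iff.1 h2
      have : ρ g = 0 := Subsingleton.elim _ _
      simp [Representation.character, this]
    rw [h3] at h1
    simp [charInner] at h1)
  obtain ⟨m, hm⟩ := exists_nat_charInner_extProd B hψ
  -- A product of irreducibles `ψ` occurs in the restriction of `ρ`. The two types of characters
  -- correspond to `ψ` being nonconstant or constant.
  by_cases hcon : ∃ i j, ψ i ≠ ψ j
  · refine Or.inr ⟨ψ, hψ, hcon, eq_of_charInner_eq hθ.charInner_self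
      (charInner_indProd_self hψ hcon) (m := m) ?_ ?_⟩
    · rintro rfl; exact hne (by simpa using hm)
    · rw [hθ.charInner_indProd hψ, ← hm, hB]
  · push Not at hcon
    left
    obtain ⟨n, σ, hσ, hσ'⟩ := hψ 0
    have hc : extProd ψ = extProd fun _ => σ.character := by
      congr 1; funext i; rw [hσ', hcon i 0]
    rw [hc, hB, ← charInner_sum_xRep] at hne
    obtain ⟨ε, _, hε⟩ := Finset.exists_ne_zero_of_sum_ne_zero hne
    obtain ⟨m, hm⟩ := exists_nat_charInner_character (xRep σ ε) ρ
    have := eq_of_charInner_eq hθ.charInner_self (charInner_xRep_self σ hσ ε) (m := m)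
      (by rintro rfl; exact hε (by simpa using hm)) hm
    exact ⟨σ.character, ε, ⟨n, σ, hσ, rfl⟩, n, σ, rfl, fun f s => by
      rw [this, character_xRep]⟩

theorem IsX.wreath_zero {φ : Syl p k → ℂ} {ε : Fin p} {θ : Syl p (k + 1) → ℂ} (h : IsX φ ε θ) :
    (fun f : Fin p → Syl p k => θ (wreath f 0)) = extProd fun _ => φ := by
  obtain ⟨n, ρ, rfl, h⟩ := h
  funext f
  rw [h, pow_zero, trace_tensorAct_one]
  simp [extProd]

theorem IsX.unique {φ : Syl p k → ℂ} {ε : Fin p} {θ θ' : Syl p (k + 1) → ℂ} (hφ : IsIrrChar φ)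
    (h : IsX φ ε θ) (h' : IsX φ ε θ') : θ = θ' := by
  obtain ⟨n, ρ, hρ, rfl⟩ := hφ
  obtain ⟨m, σ, hσ, h⟩ := h
  obtain ⟨m', σ', hσ', h'⟩ := h'
  obtain ⟨e⟩ := IsIrrChar.exists_equiv ρ σ hρ hσ.symm
  obtain ⟨e'⟩ := IsIrrChar.exists_equiv ρ σ' hρ hσ'.symm
  refine funext_wreath fun f s => ?_
  rw [h, h', ← trace_tensorAct_equiv e, ← trace_tensorAct_equiv e']

theorem IsX.params_unique {φ φ' : Syl p k → ℂ} {ε ε' : Fin p} {θ : Syl p (k + 1) → ℂ}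
    (hθ : IsIrrChar θ) (hφ : IsIrrChar φ) (hφ' : IsIrrChar φ')
    (h : IsX φ ε θ) (h' : IsX φ' ε' θ) : φ = φ' ∧ ε = ε' := by
  classical
  have hφφ : φ = φ' := by
    have h1 := charInner_extProd_of_isIrrChar (ι := Fin p) (fun _ => hφ) fun _ => hφ'
    rw [← h.wreath_zero, ← h'.wreath_zero, h.wreath_zero,
      charInner_extProd_of_isIrrChar (fun _ => hφ) fun _ => hφ, if_pos rfl] at h1
    by_contra hne
    rw [if_neg fun hc => hne (congrFun hc 0)] at h1
    exact one_ne_zero h1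
  subst hφφ
  refine ⟨rfl, ?_⟩
  -- If `θ` vanished outside the base group, its norm would be $1/p$. At a nonzero value the common
  -- trace cancels, and `ε` is read off from $\omega^{\varepsilon s}$ with `s` invertible.
  obtain ⟨s, hs, f, hf⟩ : ∃ s : ZMod p, s ≠ 0 ∧ ∃ f : Fin p → Syl p k,
      θ (wreath f s.val) ≠ 0 := by
    by_contra! hcon
    have h1 := hθ.charInner_self
    rw [charInner_syl_succ, Finset.sum_eq_single 0 _ (by simp)] at h1
    · simp only [ZMod.val_zero, h.wreath_zero,
        charInner_extProd_of_isIrrChar (fun _ : Fin p => hφ) fun _ => hφ, if_true, mul_one,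
        inv_eq_one] at h1
      exact (Fact.out : p.Prime).ne_one (by exact_mod_cast h1)
    · intro s _ hs
      simp [charInner, hcon s hs]
  obtain ⟨n, ρ, hρ, h⟩ := h
  obtain ⟨n', ρ', hρ', h'⟩ := h'
  obtain ⟨m, σ, hσ, hσ'⟩ := hφ
  obtain ⟨e⟩ := IsIrrChar.exists_equiv σ ρ hσ (hσ'.trans hρ.symm)
  obtain ⟨e'⟩ := IsIrrChar.exists_equiv σ ρ' hσ (hσ'.trans hρ'.symm)
  have h2 := h' f s.val
  rw [h, ← trace_tensorAct_equiv e, ← trace_tensorAct_equiv e'] at h2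
  rw [h, ← trace_tensorAct_equiv e] at hf
  have h3 := mul_left_cancel₀ (left_ne_zero_of_mul hf) h2
  rw [omega_pow_eq_iff] at h3
  push_cast at h3
  rw [ZMod.natCast_zmod_val] at h3
  have h4 := mul_right_cancel₀ hs h3
  rw [ZMod.natCast_eq_natCast_iff', Nat.mod_eq_of_lt ε.2, Nat.mod_eq_of_lt ε'.2] at h4
  exact Fin.ext h4

/-- The restriction of $\mathcal X(\varphi;\varepsilon)$ is a constant product, orthogonal to every
rotation of the nonconstant `ϑ`; the norm would be `0` instead of `1`. -/
theorem not_isX_indProd {ϑ : Fin p → Syl p k → ℂ} (hϑ : ∀ i, IsIrrChar (ϑ i))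
    (hne : ∃ i j, ϑ i ≠ ϑ j) {φ : Syl p k → ℂ} (hφ : IsIrrChar φ) (ε : Fin p) :
    ¬ IsX φ ε (indProd ϑ) := by
  classical
  intro h
  have h1 := charInner_indProd_self hϑ hne
  rw [charInner_indProd hϑ, h.wreath_zero, Finset.sum_eq_zero, mul_zero] at h1
  · exact zero_ne_one h1
  · intro r _
    rw [charInner_extProd_of_isIrrChar (fun _ => hφ) fun _ => hϑ _, if_neg]
    intro hc
    obtain ⟨i, j, hij⟩ := hne
    have hi := congrFun hc ((rot p ^ r.val) i)
    have hj := congrFun hc ((rot p ^ r.val) j)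
    simp only [Equiv.Perm.coe_inv, Equiv.symm_apply_apply] at hi hj
    exact hij (hi.symm.trans hj)

end classification

/-! ### Conjugation of characters by the permutations $\sigma_j$ -/

section conjugation

variable {p : ℕ} [NeZero p] {k : ℕ}

/-- Conjugation by `h⁻¹` as an endomorphism of `P_{p ^ k}`. -/
def conjHom (h : Nor p k) : Syl p k →* Syl p k where
  toFun g := ⟨(h : Equiv.Perm (Fin (p ^ k)))⁻¹ * g * h,
    (Subgroup.mem_normalizer_iff''.1 h.2 _).1 g.2⟩
  map_one' := Subtype.ext (by simp)
  map_mul' g g' := Subtype.ext (by simp [mul_assoc])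

theorem coe_conjHom (h : Nor p k) (g : Syl p k) :
    (conjHom h g : Equiv.Perm (Fin (p ^ k))) = (h : Equiv.Perm (Fin (p ^ k)))⁻¹ * g * h := rfl

theorem conjChar_apply (h : Nor p k) (θ : Syl p k → ℂ) (g : Syl p k) :
    conjChar h θ g = θ (conjHom h g) := rfl

theorem conjHom_surjective (h : Nor p k) : Function.Surjective (conjHom h) := fun g =>
  ⟨conjHom h⁻¹ g, Subtype.ext (by simp [coe_conjHom, mul_assoc])⟩

theorem IsIrrChar.comp {G H : Type*} [Group G] [Group H] {χ : G → ℂ} (hχ : IsIrrChar χ)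
    {i : H →* G} (hi : Function.Surjective i) : IsIrrChar fun x => χ (i x) := by
  obtain ⟨n, ρ, hρ, rfl⟩ := hχ
  let ρ' : Representation ℂ H (Fin n → ℂ) := (ρ : _ →* _).comp i
  refine ⟨n, ρ', ?_, rfl⟩
  let o : Subrepresentation ρ ≃o Subrepresentation ρ' :=
    { toFun := fun N => ⟨N.toSubmodule, fun g => N.apply_mem_toSubmodule (i g)⟩
      invFun := fun N => ⟨N.toSubmodule, fun g => by
        obtain ⟨x, rfl⟩ := hi g
        exact N.apply_mem_toSubmodule x⟩
      left_inv := fun _ => rfl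
      right_inv := fun _ => rfl
      map_rel_iff' := Iff.rfl }
  exact (OrderIso.isSimpleOrder_iff o).1 hρ

theorem IsIrrChar.conjChar {θ : Syl p k → ℂ} (hθ : IsIrrChar θ) (h : Nor p k) :
    IsIrrChar (conjChar h θ) :=
  hθ.comp (conjHom_surjective h)

theorem conjChar_injective (h : Nor p k) : Function.Injective (conjChar h) := fun θ θ' e => by
  funext g
  obtain ⟨g, rfl⟩ := conjHom_surjective h g
  exact congrFun e g

theorem coe_sigmaN_castSucc (a : (ZMod p)ˣ) (j : Fin k) :
    (sigmaN a (k + 1) j.castSucc : Equiv.Perm (Fin (p ^ (k + 1)))) =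
      wr (fun _ => (sigmaN a k j : Equiv.Perm (Fin (p ^ k)))) 1 := by
  simp [sigmaN, sigma]

theorem coe_sigmaN_last (a : (ZMod p)ˣ) :
    (sigmaN a (k + 1) (Fin.last k) : Equiv.Perm (Fin (p ^ (k + 1)))) = wr 1 (sigmaOne a) := by
  simp [sigmaN, sigma]

theorem conjHom_sigmaN_castSucc (a : (ZMod p)ˣ) (j : Fin k) (f : Fin p → Syl p k) (s : ℕ) :
    conjHom (sigmaN a (k + 1) j.castSucc) (wreath f s) =
      wreath (fun i => conjHom (sigmaN a k j) (f i)) s := by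
  apply Subtype.ext
  rw [coe_conjHom, coe_sigmaN_castSucc, coe_wreath, coe_wreath, mul_assoc, inv_mul_eq_iff_eq_mul,
    wr_mul, wr_mul]
  simp [coe_conjHom, mul_assoc]

/-- On residues both sides are $i\mapsto ai+s$. This is where $b=a^{-1}$ enters the exponents. -/
theorem sigmaOne_conj_pow (a : (ZMod p)ˣ) (s : ℕ) :
    sigmaOne a * rot p ^ (((a⁻¹ : (ZMod p)ˣ) : ZMod p).val * s) = rot p ^ s * sigmaOne a := by
  ext1 i
  apply (residue p).injective
  simp only [Equiv.Perm.mul_apply, residue_sigmaOne, residue_rot_pow]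
  push_cast
  rw [ZMod.natCast_zmod_val, mul_add, ← mul_assoc (a : ZMod p), Units.mul_inv, one_mul]

theorem conjHom_sigmaN_last (a : (ZMod p)ˣ) (f : Fin p → Syl p k) (s : ℕ) :
    conjHom (sigmaN a (k + 1) (Fin.last k)) (wreath f s) =
      wreath (fun i => f (sigmaOne a i)) (((a⁻¹ : (ZMod p)ˣ) : ZMod p).val * s) := by
  apply Subtype.ext
  rw [coe_conjHom, coe_sigmaN_last, coe_wreath, coe_wreath, mul_assoc, inv_mul_eq_iff_eq_mul,
    wr_mul, wr_mul, sigmaOne_conj_pow]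
  simp

theorem IsX.conjChar_castSucc {φ : Syl p k → ℂ} {ε : Fin p} {θ : Syl p (k + 1) → ℂ}
    (h : IsX φ ε θ) (a : (ZMod p)ˣ) (j : Fin k) :
    IsX (conjChar (sigmaN a k j) φ) ε (conjChar (sigmaN a (k + 1) j.castSucc) θ) := by
  obtain ⟨n, ρ, rfl, h⟩ := h
  refine ⟨n, (ρ : _ →* _).comp (conjHom (sigmaN a k j)), rfl, fun f s => ?_⟩
  rw [conjChar_apply, conjHom_sigmaN_castSucc, h]
  rfl

/-- The trace is unchanged because `sigmaOne a` permutes the tensor factors; the exponent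
$\varepsilon\cdot bs$ of $\omega$ is regrouped as $(b\varepsilon)s$. -/
theorem IsX.conjChar_last {φ : Syl p k → ℂ} {ε ε' : Fin p} {θ : Syl p (k + 1) → ℂ}
    (h : IsX φ ε θ) (a : (ZMod p)ˣ)
    (hε : ((ε' : ℕ) : ZMod p) = (a⁻¹ : (ZMod p)ˣ) * ((ε : ℕ) : ZMod p)) :
    IsX φ ε' (conjChar (sigmaN a (k + 1) (Fin.last k)) θ) := by
  obtain ⟨n, ρ, hρ, h⟩ := h
  refine ⟨n, ρ, hρ, fun f s => ?_⟩
  rw [conjChar_apply, conjHom_sigmaN_last, h]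
  congr 1
  · rw [← trace_tensorAct_conj ρ f _ (sigmaOne a), mul_assoc, ← sigmaOne_conj_pow,
      inv_mul_cancel_left]
  · rw [omega_pow_eq_iff]
    push_cast
    rw [hε, ZMod.natCast_zmod_val]
    ring

theorem conjChar_castSucc_indProd {ϑ : Fin p → Syl p k → ℂ} (hϑ : ∀ i, IsIrrChar (ϑ i))
    (a : (ZMod p)ˣ) (j : Fin k) :
    conjChar (sigmaN a (k + 1) j.castSucc) (indProd ϑ) =
      indProd fun i => conjChar (sigmaN a k j) (ϑ i) := by
  refine funext_wreath fun f s => ?_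
  rw [conjChar_apply, conjHom_sigmaN_castSucc, indProd_wreath hϑ,
    indProd_wreath fun i => (hϑ i).conjChar _]
  rfl

theorem conjChar_last_indProd {ϑ : Fin p → Syl p k → ℂ} (hϑ : ∀ i, IsIrrChar (ϑ i))
    (a : (ZMod p)ˣ) :
    conjChar (sigmaN a (k + 1) (Fin.last k)) (indProd ϑ) = indProd fun i => ϑ (tau a i) := by
  refine funext_wreath fun f s => ?_
  rw [conjChar_apply, conjHom_sigmaN_last, indProd_wreath hϑ, indProd_wreath fun i => hϑ _]
  have h0 : ((((a⁻¹ : (ZMod p)ˣ) : ZMod p).val * s : ℕ) : ZMod p) = 0 ↔ (s : ZMod p) = 0 := by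
    push_cast
    rw [ZMod.natCast_zmod_val, Units.mul_right_eq_zero]
  simp only [h0]
  congr 1
  -- Moving `sigmaOne a` past `rot p ^ r` multiplies the exponent by `a`, which only permutes the
  -- rotations.
  refine Fintype.sum_equiv a.mulLeft _ _ fun r => ?_
  rw [extProd_comp_perm]
  congr 1
  funext i
  congr 1
  change ((rot p ^ r.val)⁻¹ * (sigmaOne a)⁻¹) i = ((sigmaOne a)⁻¹ * (rot p ^ _)⁻¹) i
  congr 1
  rw [← mul_inv_rev, ← mul_inv_rev, inv_inj, ← sigmaOne_conj_pow]
  congr 1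
  rw [rot_pow_eq_iff]
  push_cast
  simp

end conjugation

/-! ### Recursive description of tree functions -/

section trees

variable {p : ℕ} [NeZero p] {k : ℕ}

/-- A family `γ` of rotations consists of one at the root and an independent family for each
subtree. -/
theorem LabelFn.equiv_iff (t t' : LabelFn p (k + 1)) :
    TreeFn.mk t = TreeFn.mk t' ↔ t.root = t'.root ∧
      ∃ δ ∈ Subgroup.zpowers (rot p), ∀ i, TreeFn.mk (t.sub i) = TreeFn.mk (t'.sub (δ i)) := by
  have hmk : ∀ {k : ℕ} (u u' : LabelFn p k), TreeFn.mk u = TreeFn.mk u' ↔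
      ∃ γ : List (Fin p) → Equiv.Perm (Fin p), (∀ q, γ q ∈ Subgroup.zpowers (rot p)) ∧
        ∀ s : Skel p k, u s = u' ⟨relabel γ s, by rw [relabel_length]; exact s.2⟩ :=
    fun u u' => Quotient.eq
  simp only [hmk]
  constructor
  · rintro ⟨γ, hγ, h⟩
    exact ⟨h ⟨[], Nat.succ_pos k⟩, γ [], hγ _, fun i => ⟨fun q => γ (i :: q), fun q => hγ _,
      fun s => h ⟨i :: s.1, Nat.succ_lt_succ s.2⟩⟩⟩
  · rintro ⟨hr, δ, hδ, h⟩
    choose γ hγ h using h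
    refine ⟨fun q => List.casesOn q δ γ, fun q => ?_, ?_⟩
    · cases q with
      | nil => exact hδ
      | cons i q => exact hγ i q
    · rintro ⟨_ | ⟨i, s⟩, hs⟩
      · exact hr
      · exact h i ⟨s, Nat.lt_of_succ_lt_succ hs⟩

theorem TreeFn.mk_out (T : TreeFn p k) : TreeFn.mk (Quotient.out T) = T := Quotient.out_eq T

theorem TreeFn.node_eq_iff {T T' : Fin p → TreeFn p k} {x x' : Fin (p + 1)} :
    TreeFn.node T x = TreeFn.node T' x' ↔
      x = x' ∧ ∃ δ ∈ Subgroup.zpowers (rot p), ∀ i, T i = T' (δ i) := by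
  rw [TreeFn.node, TreeFn.node, LabelFn.equiv_iff]
  have : ∀ (T : Fin p → TreeFn p k) (x : Fin (p + 1)) i,
      TreeFn.mk (LabelFn.sub (LabelFn.node (fun i => Quotient.out (T i)) x) i) = T i :=
    fun T x i => TreeFn.mk_out (T i)
  simp only [this]
  rfl

theorem TreeFn.node_mk (t : Fin p → LabelFn p k) (x : Fin (p + 1)) :
    TreeFn.node (fun i => TreeFn.mk (t i)) x = TreeFn.mk (LabelFn.node t x) := by
  rw [TreeFn.node, LabelFn.equiv_iff]
  exact ⟨rfl, 1, Subgroup.one_mem _, fun i => TreeFn.mk_out (TreeFn.mk (t i))⟩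

theorem TreeFn.admissible_node {T : Fin p → TreeFn p k} {x : Fin (p + 1)}
    (hT : ∀ i, (T i).Admissible) (h1 : x ≠ Fin.last p → ∀ i j, T i = T j)
    (h2 : x = Fin.last p → ∃ i j, T i ≠ T j) : (TreeFn.node T x).Admissible := by
  choose t ht hadm using hT
  obtain rfl : (fun i => TreeFn.mk (t i)) = T := funext ht
  refine ⟨_, (TreeFn.node_mk t x).symm, ?_⟩
  cases k with
  | zero =>
    -- The children of a leaf are empty tree functions, all equal, so the hypothesis for label `p`
    -- cannot be met.
    intro hx
    obtain ⟨i, j, hij⟩ := h2 hx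
    refine hij (congrArg TreeFn.mk (funext fun s => ?_))
    exact absurd s.2 (Nat.not_lt_zero _)
  | succ k => exact ⟨hadm, h1, h2⟩

end trees

/-! ### The correspondence $\mathcal T$: independence of choices, injectivity, admissibility -/

section treeOf

variable {p : ℕ} [Fact p.Prime] {k : ℕ}

theorem treeOf_of_isX {φ : Syl p k → ℂ} {ε : Fin p} {θ : Syl p (k + 1) → ℂ}
    (hθ : IsIrrChar θ) (hφ : IsIrrChar φ) (h : IsX φ ε θ) :
    treeOf θ = TreeFn.node (fun _ => treeOf φ) ε.castSucc := by
  have hex : ∃ φε : (Syl p k → ℂ) × Fin p, IsIrrChar φε.1 ∧ IsX φε.1 φε.2 θ := ⟨(φ, ε), hφ, h⟩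
  rw [treeOf, dif_pos hex]
  obtain ⟨h1, h2⟩ := IsX.params_unique hθ hex.choose_spec.1 hφ hex.choose_spec.2 h
  rw [h1, h2]

/-- The tuple chosen inside `treeOf` may differ from `ϑ`, but only by a rotation, which the tree
function absorbs. -/
theorem treeOf_indProd {ϑ : Fin p → Syl p k → ℂ} (hϑ : ∀ i, IsIrrChar (ϑ i))
    (hne : ∃ i j, ϑ i ≠ ϑ j) :
    treeOf (indProd ϑ) = TreeFn.node (fun i => treeOf (ϑ i)) (Fin.last p) := by
  have hex : ∃ ϑ' : Fin p → Syl p k → ℂ,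
      (∀ i, IsIrrChar (ϑ' i)) ∧ (∃ i j, ϑ' i ≠ ϑ' j) ∧ indProd ϑ = indProd ϑ' :=
    ⟨ϑ, hϑ, hne, rfl⟩
  rw [treeOf, dif_neg, dif_pos hex, TreeFn.node_eq_iff]
  · refine ⟨rfl, ?_⟩
    obtain ⟨δ, hδ, h⟩ := exists_eq_comp_of_indProd_eq hex.choose_spec.1 hϑ (by
      rw [← hex.choose_spec.2.2, charInner_indProd_self hϑ hne]
      exact one_ne_zero)
    exact ⟨δ, hδ, fun i => by rw [h i]⟩
  · rintro ⟨⟨φ, ε⟩, hφ, h⟩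
    exact not_isX_indProd hϑ hne hφ ε h

theorem IsIrrChar.eq_of_zero {θ θ' : Syl p 0 → ℂ} (hθ : IsIrrChar θ) (hθ' : IsIrrChar θ') :
    θ = θ' := by
  have hsub : Subsingleton (Equiv.Perm (Fin (p ^ 0))) :=
    have : Subsingleton (Fin (p ^ 0)) := by rw [pow_zero]; infer_instance
    inferInstance
  have hs : Subsingleton (Syl p 0) := inferInstance
  have key : ∀ {χ : Syl p 0 → ℂ}, IsIrrChar χ → χ = fun _ => 1 := by
    intro χ hχ
    have h1 := hχ.charInner_self
    obtain ⟨n, ρ, hρ, rfl⟩ := hχ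
    funext g
    obtain rfl := Subsingleton.elim 1 g
    have : Unique (Syl p 0) := { default := 1, uniq := fun _ => Subsingleton.elim _ _ }
    rw [charInner, Fintype.sum_unique, Nat.card_unique] at h1
    rw [Subsingleton.elim (default : Syl p 0) 1] at h1
    rw [Representation.char_one] at h1 ⊢
    norm_num at h1
    have : n * n = 1 := by exact_mod_cast h1
    have : n = 1 := Nat.eq_one_of_mul_eq_one_right this
    simp [this]
  rw [key hθ, key hθ']

/-- The root label separates the two types and gives `ε`; induction recovers the characters below
the root, for induced characters up to a rotation. -/
theorem treeOf_injective : ∀ {k : ℕ} {θ θ' : Syl p k → ℂ}, IsIrrChar θ → IsIrrChar θ' →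
    treeOf θ = treeOf θ' → θ = θ'
  | 0, _, _, hθ, hθ', _ => hθ.eq_of_zero hθ'
  | k + 1, θ, θ', hθ, hθ', h => by
    rcases hθ.classification with ⟨φ, ε, hφ, hX⟩ | ⟨ϑ, hϑ, hne, rfl⟩ <;>
    rcases hθ'.classification with ⟨φ', ε', hφ', hX'⟩ | ⟨ϑ', hϑ', hne', rfl⟩
    · rw [treeOf_of_isX hθ hφ hX, treeOf_of_isX hθ' hφ' hX', TreeFn.node_eq_iff] at h
      obtain ⟨hε, _, _, h⟩ := h
      obtain rfl := Fin.castSucc_injective _ hε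
      obtain rfl := treeOf_injective hφ hφ' (h 0)
      exact hX.unique hφ hX'
    · rw [treeOf_of_isX hθ hφ hX, treeOf_indProd hϑ' hne', TreeFn.node_eq_iff] at h
      exact absurd h.1 (Fin.castSucc_lt_last ε).ne
    · rw [treeOf_indProd hϑ hne, treeOf_of_isX hθ' hφ' hX', TreeFn.node_eq_iff] at h
      exact absurd h.1.symm (Fin.castSucc_lt_last ε').ne
    · rw [treeOf_indProd hϑ hne, treeOf_indProd hϑ' hne', TreeFn.node_eq_iff] at h
      obtain ⟨_, δ, hδ, h⟩ := h
      have h' : ∀ i, ϑ i = ϑ' (δ i) := fun i => treeOf_injective (hϑ i) (hϑ' _) (h i)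
      obtain ⟨s, rfl⟩ := (mem_powers_iff_mem_zpowers (x := rot p)).2 hδ
      refine funext_wreath fun f t => ?_
      rw [indProd_wreath hϑ, indProd_wreath hϑ']
      congr 1
      -- Rotating the tuple by `s` shifts the index of the sum over rotations.
      refine Fintype.sum_equiv (Equiv.subRight (s : ZMod p)) _ _ fun r => ?_
      congr 1
      funext i
      rw [h']
      congr 1
      change (rot p ^ s * (rot p ^ r.val)⁻¹) i = (rot p ^ _)⁻¹ i
      congr 1
      rw [mul_inv_eq_iff_eq_mul, eq_inv_mul_iff_mul_eq, ← pow_add, rot_pow_eq_iff]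
      push_cast
      simp

theorem treeAct_treeOf {θ : Syl p k → ℂ} (hθ : IsIrrChar θ) (h : Nor p k) :
    treeAct h (treeOf θ) = treeOf (conjChar h θ) := by
  have hex : ∃ θ' : Syl p k → ℂ, IsIrrChar θ' ∧ treeOf θ' = treeOf θ := ⟨θ, hθ, rfl⟩
  rw [treeAct, dif_pos hex, treeOf_injective hex.choose_spec.1 hθ hex.choose_spec.2]

theorem treeOf_admissible : ∀ {k : ℕ} {θ : Syl p k → ℂ}, IsIrrChar θ → (treeOf θ).Admissible
  | 0, _, _ => ⟨fun _ => 0, by rw [treeOf], trivial⟩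
  | k + 1, θ, hθ => by
    rcases hθ.classification with ⟨φ, ε, hφ, hX⟩ | ⟨ϑ, hϑ, ⟨i, j, hij⟩, rfl⟩
    · rw [treeOf_of_isX hθ hφ hX]
      exact TreeFn.admissible_node (fun _ => treeOf_admissible hφ) (fun _ _ _ => rfl)
        fun h => absurd h (Fin.castSucc_lt_last ε).ne
    · rw [treeOf_indProd hϑ ⟨i, j, hij⟩]
      exact TreeFn.admissible_node (fun i => treeOf_admissible (hϑ i)) (fun h => absurd rfl h)
        fun _ => ⟨i, j, fun h => hij (treeOf_injective (hϑ i) (hϑ j) h)⟩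

/-- Reconciles the two conventions: a position `i : Fin p` stands for `i + 1`, whereas a label
stands for itself. -/
theorem residue_eq_succ {p : ℕ} [NeZero p] (i : Fin p) :
    residue p i = ((i.succ : ℕ) : ZMod p) := by
  have : (ZMod.finEquiv p i : ZMod p) = ((i : ℕ) : ZMod p) := by
    obtain ⟨n, rfl⟩ := Nat.exists_eq_succ_of_ne_zero (NeZero.ne p)
    exact (Fin.cast_val_eq_self i).symm
  simp [residue, this]

theorem tauLabel_cast (a : (ZMod p)ˣ) (x : Fin (p + 1)) :
    ((tauLabel a x : ℕ) : ZMod p) = (a⁻¹ : (ZMod p)ˣ) * ((x : ℕ) : ZMod p) := by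
  induction x using Fin.cases with
  | zero => rw [tauLabel, Fin.cases_zero, Fin.val_zero, Nat.cast_zero, mul_zero]
  | succ i =>
    have h := residue_sigmaOne a (tau a i)
    rw [tau, Equiv.Perm.coe_inv, Equiv.apply_symm_apply] at h
    rw [← residue_eq_succ, h, Units.inv_mul_cancel_left]
    exact (residue_eq_succ _).symm

theorem tauLabel_eq_zero_iff (a : (ZMod p)ˣ) (x : Fin (p + 1)) : tauLabel a x = 0 ↔ x = 0 := by
  induction x using Fin.cases with
  | zero => exact iff_of_true rfl rfl
  | succ i => exact iff_of_false (Fin.succ_ne_zero _) (Fin.succ_ne_zero _)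

/-- The labels `0` and `p` share a residue, so `tauLabel_cast` leaves both possible;
`tauLabel_eq_zero_iff` excludes `0`. -/
theorem tauLabel_last (a : (ZMod p)ˣ) : tauLabel a (Fin.last p) = Fin.last p := by
  have h := tauLabel_cast a (Fin.last p)
  rw [Fin.val_last, ZMod.natCast_self, mul_zero, ZMod.natCast_eq_zero_iff] at h
  have h0 : (tauLabel a (Fin.last p) : ℕ) ≠ 0 := fun h0 => by
    have := (tauLabel_eq_zero_iff a (Fin.last p)).1 (Fin.ext h0)
    exact NeZero.ne p (congrArg Fin.val this)
  exact Fin.ext (le_antisymm (Fin.le_last _) (Nat.le_of_dvd (Nat.pos_of_ne_zero h0) h))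

theorem exists_tauLabel_castSucc (a : (ZMod p)ˣ) (ε : Fin p) :
    ∃ ε' : Fin p, tauLabel a ε.castSucc = ε'.castSucc := by
  suffices h : tauLabel a ε.castSucc ≠ Fin.last p by
    obtain ⟨ε', h⟩ := Fin.exists_castSucc_eq.2 h
    exact ⟨ε', h.symm⟩
  intro h
  have h1 := tauLabel_cast a ε.castSucc
  rw [h, Fin.val_last, ZMod.natCast_self, eq_comm, Units.mul_right_eq_zero,
    ZMod.natCast_eq_zero_iff] at h1
  have h2 : ε.castSucc = 0 := Fin.ext (Nat.eq_zero_of_dvd_of_lt h1 ε.2)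
  rw [h2, (tauLabel_eq_zero_iff a 0).2 rfl] at h
  exact NeZero.ne p (congrArg Fin.val h).symm

end treeOf

end SylowTree

theorem theorem1 (p : ℕ) [Fact p.Prime]
    (a : (ZMod p)ˣ) (ha : ∀ c : (ZMod p)ˣ, c ∈ Subgroup.zpowers a)
    (k : ℕ) (θ : Syl p (k + 1) → ℂ) (hθ : IsIrrChar θ)
    (T : Fin p → TreeFn p k) (x : Fin (p + 1)) (hT : treeOf θ = TreeFn.node T x) :
    (treeOf θ).Admissible ∧ (∀ i, (T i).Admissible) ∧
    (∀ h : Nor p (k + 1), treeAct h (treeOf θ) = treeOf (conjChar h θ)) ∧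
    (∀ j : Fin k, treeAct (sigmaN a (k + 1) j.castSucc) (treeOf θ) =
      TreeFn.node (fun i => treeAct (sigmaN a k j) (T i)) x) ∧
    treeAct (sigmaN a (k + 1) (Fin.last k)) (treeOf θ) =
      TreeFn.node (fun i => T (tau a i)) (tauLabel a x) := by
  refine ⟨treeOf_admissible hθ, ?_⟩
  simp only [treeAct_treeOf hθ, implies_true, true_and]
  rcases hθ.classification with ⟨φ, ε, hφ, hX⟩ | ⟨ϑ, hϑ, hne, rfl⟩
  · rw [treeOf_of_isX hθ hφ hX, TreeFn.node_eq_iff] at hT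
    obtain ⟨rfl, δ, hδ, hT⟩ := hT
    -- The subtrees are given only up to rotation, which is harmless for a constant family.
    obtain rfl : T = fun _ => treeOf φ := funext fun i => by
      rw [hT (δ⁻¹ i)]; simp
    refine ⟨fun _ => treeOf_admissible hφ, fun j => ?_, ?_⟩
    · rw [treeOf_of_isX (hθ.conjChar _) (hφ.conjChar _) (hX.conjChar_castSucc a j)]
      simp only [treeAct_treeOf hφ]
    · obtain ⟨ε', hε'⟩ := exists_tauLabel_castSucc a ε
      have h := tauLabel_cast a ε.castSucc
      rw [hε'] at h ⊢
      rw [treeOf_of_isX (hθ.conjChar _) hφ (hX.conjChar_last a h)]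
  · rw [treeOf_indProd hϑ hne, TreeFn.node_eq_iff] at hT
    obtain ⟨rfl, δ, hδ, hT⟩ := hT
    obtain rfl : T = fun i => treeOf (ϑ (δ⁻¹ i)) := funext fun i => by
      rw [hT (δ⁻¹ i)]; simp
    have hne' := hne
    obtain ⟨i, j, hij⟩ := hne'
    refine ⟨fun _ => treeOf_admissible (hϑ _), fun l => ?_, ?_⟩
    · rw [conjChar_castSucc_indProd hϑ, treeOf_indProd (fun i => (hϑ i).conjChar _)
        ⟨i, j, (conjChar_injective _).ne hij⟩, TreeFn.node_eq_iff]
      exact ⟨rfl, δ, hδ, fun i => by simp [treeAct_treeOf (hϑ i)]⟩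
    · rw [conjChar_last_indProd hϑ, treeOf_indProd (fun i => hϑ _)
        ⟨(tau a)⁻¹ i, (tau a)⁻¹ j, by simpa using hij⟩, tauLabel_last, TreeFn.node_eq_iff]
      obtain ⟨s, rfl⟩ := (mem_powers_iff_mem_zpowers (x := rot p)).2 hδ
      -- The tuple `T` is `ϑ` rotated by $\delta=\gamma^s$; after permuting by `tau a`, the two
      -- tuples differ by $\sigma\delta\sigma^{-1}=\gamma^{as}$, where $\sigma$ is `sigmaOne a`.
      refine ⟨rfl, rot p ^ ((a : ZMod p).val * s), Subgroup.npow_mem_zpowers _ _, fun i => ?_⟩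
      have h : sigmaOne a * rot p ^ s = rot p ^ ((a : ZMod p).val * s) * sigmaOne a := by
        rw [← sigmaOne_conj_pow]
        congr 1
        rw [rot_pow_eq_iff, Nat.cast_mul, Nat.cast_mul, ZMod.natCast_zmod_val,
          ZMod.natCast_zmod_val, Units.inv_mul_cancel_left]
      have h' : ∀ i, (rot p ^ s)⁻¹ (tau a ((rot p ^ ((a : ZMod p).val * s)) i)) = tau a i := by
        intro i
        change ((rot p ^ s)⁻¹ * ((sigmaOne a)⁻¹ * rot p ^ ((a : ZMod p).val * s))) i = _
        rw [← mul_assoc, ← mul_inv_rev, h, mul_inv_rev, inv_mul_cancel_right]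
        rfl
      exact congrArg (fun i => treeOf (ϑ i)) (h' i).symm
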